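/- Let $\lambda_1,\lambda_2>0$ and $\mu_2\ge 0$. Let $S=\bigcup_{n\ge 1}\mathbb{N}^n$ (with $0\in\mathbb{N}$), and for $\mathbf{x}=(x^1,\dots,x^n)\in S$ put $\ell(\mathbf{x})=n$ and $\|\mathbf{x}\|=\sum_{i=1}^n x^i$. Let $\mathbf{d}=(\mathbf{d}_t)_{t\in\mathbb{N}}$, $\mathbf{d}_t=(d_t^1,\dots,d_t^{\ell(\mathbf{d}_t)})$, be the Markov chain on $S$ (the vertex in-degrees of the preferential attachment–detachment graph at time $t$) that starts at the one-term sequence $(1)$ and moves from $\mathbf{x}$ as follows, where $Z=(\lambda_2+\mu_2)\|\mathbf{x}\|+\ell(\mathbf{x})\lambda_1$: for each $1\le i\le \ell(\mathbf{x})$ the entry $x^i$ is raised by one with probability $x^i\lambda_2/Z$ and lowered by one with probability $x^i\mu_2/Z$, and a new last entry $1$ is appended with probability $\ell(\mathbf{x})\lambda_1/Z$. Let $d(V_t)$ be the in-degree of a vertex chosen uniformly at random at time $t$, that is, a random variable with $$\mathbb{P}(d(V_t)=j\mid \ell(\mathbf{d}_t)=n)=\frac1n\sum_{i=1}^n\mathbb{P}(d_t^i=j\mid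 \ell(\mathbf{d}_t)=n),\qquad n\ge 1,\ j\in\mathbb{N}.$$ Then the limits $p_j:=\lim_{t\to\infty}\mathbb{P}(d(V_t)=j)$, $j\in\mathbb{N}$, exist, and $(p_j)_{j\ge 0}$ is a probability distribution. Writing $f\sim g$ for $f(j)/g(j)\to 1$ as $j\to\infty$, we have: (i) If $\mu_2=0$, then $p_j\sim c_1\, j^{-(1+\lambda_1/\lambda_2)}$ with $c_1=\frac{\lambda_1}{\lambda_2}\Gamma\big(1+\frac{\lambda_1}{\lambda_2}\big)$. (ii) If $\mu_2>0$ and $\lambda_2>\mu_2$, then $p_j\sim c_2\, j^{-\left(1+\frac{\lambda_1}{\lambda_2-\mu_2}\right)}$ with $c_2=\frac{\lambda_1}{\lambda_2}\big(\frac{\lambda_2}{\lambda_2-\mu_2}\big)^{\frac{\lambda_1}{\lambda_2-\mu_2}}\Gamma\big(1+\frac{\lambda_1}{\lambda_2-\mu_2}\big)$. (iii) If $\mu_2>0$ and $\lambda_2<\mu_2$, then $p_j\sim c_3\big(\frac{\lambda_2}{\mu_2}\big)^{j+1} j^{-\left(1+\frac{\lambda_1}{\mu_2-\lambda_2}\right)}$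 with $c_3=\frac{\lambda_1\mu_2}{\lambda_2^2}\big(\frac{\mu_2}{\mu_2-\lambda_2}\big)^{\frac{\lambda_1}{\mu_2-\lambda_2}}\Gamma\big(1+\frac{\lambda_1}{\mu_2-\lambda_2}\big)$. (iv) If $\mu_2>0$ and $\lambda_2=\mu_2$, then $j^m p_j\to 0$ as $j\to\infty$ for every $m\in\mathbb{N}$, but $e^{\varepsilon j}p_j\to+\infty$ for every $\varepsilon>0$. Moreover, the expectation of a random variable $d(V_\infty)$ with distribution $(p_j)_{j\ge 0}$ is $$\mathbb{E}[d(V_\infty)]=\begin{cases}\dfrac{\lambda_1}{\lambda_1-(\lambda_2-\mu_2)} & \text{if } \lambda_2<\mu_2 \text{ or } 0<\lambda_2-\mu_2<\lambda_1,\\ 1 & \text{if }\lambda_2=\mu_2,\\ \infty & \text{otherwise.}\end{cases}$$ -/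

import Mathlib

open MeasureTheory ProbabilityTheory Filter Topology
open scoped ENNReal

/-- The state space `⋃_{n ≥ 1} ℕⁿ`: nonempty finite sequences of natural numbers. A state
`(x¹, …, xⁿ)` lists the in-degrees of the vertices `1, …, n`. -/
@[ext]
structure InDegreeState : Type where
  /-- The sequence `(x¹, …, xⁿ)`. -/
  toList : List ℕ
  ne_nil : toList ≠ []

namespace InDegreeState

/-- The countable state space carries the discrete σ-algebra. -/
instance : MeasurableSpace InDegreeState := ⊤

/-- The state `(1)`: one vertex, of in-degree one. -/
def start : InDegreeState := ⟨[1], by simp⟩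

/-- The length `ℓ(x)`, i.e. the number of vertices. -/
def len (x : InDegreeState) : ℕ := x.toList.length

/-- The sum `‖x‖` of all entries, i.e. the number of edges. -/
def total (x : InDegreeState) : ℕ := x.toList.sum

/-- The in-degree of the vertex with number `i + 1` (so vertices are numbered from zero here);
it is `0` if there is no such vertex. -/
def entry (x : InDegreeState) (i : ℕ) : ℕ := x.toList.getD i 0

end InDegreeState

open Classical in
/-- The transition probability `p_{x,y}` of the preferential attachment-detachment chain.
With `Z = (λ₂ + μ₂) ‖x‖ + ℓ(x) λ₁`, the chain moves from `x` to `x` with the `i`-th entry raised by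
one with probability `xⁱ λ₂ / Z`, to `x` with the `i`-th entry lowered by one with probability
`xⁱ μ₂ / Z` (which is zero if `xⁱ = 0`, so truncated subtraction plays no role), and to `x` with an
entry `1` appended with probability `ℓ(x) λ₁ / Z`. All these targets are different from each other
whenever the probabilities are positive; every other `p_{x,y}` is zero. -/
noncomputable def attachDetachProb (lam1 lam2 mu2 : ℝ) (x y : InDegreeState) : ℝ :=
  ((∑ i ∈ Finset.range x.len,
      if y.toList = x.toList.set i (x.entry i + 1) then (x.entry i : ℝ) * lam2 else 0) +
    (∑ i ∈ Finset.range x.len,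
      if y.toList = x.toList.set i (x.entry i - 1) then (x.entry i : ℝ) * mu2 else 0) +
    (if y.toList = x.toList ++ [1] then (x.len : ℝ) * lam1 else 0)) /
  ((lam2 + mu2) * (x.total : ℝ) + (x.len : ℝ) * lam1)

/-- `d` is a discrete-time Markov chain on the probability space `(Ω, P)` with state space
`⋃_{n ≥ 1} ℕⁿ`, initial distribution the point mass at `(1)`, and the transition probabilities
`attachDetachProb lam1 lam2 mu2`. -/
structure IsAttachDetachChain {Ω : Type*} [MeasurableSpace Ω] (lam1 lam2 mu2 : ℝ)
    (P : Measure Ω) (d : ℕ → Ω → InDegreeState) : Prop where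
  measurable : ∀ t, Measurable (d t)
  initial : P {ω | d 0 ω = InDegreeState.start} = 1
  markov : ∀ (t : ℕ) (x : ℕ → InDegreeState) (y : InDegreeState),
    P.real {ω | (∀ s ≤ t, d s ω = x s) ∧ d (t + 1) ω = y} =
      P.real {ω | ∀ s ≤ t, d s ω = x s} * attachDetachProb lam1 lam2 mu2 (x t) y

/-- `D t` is, at each time `t`, the in-degree `d(V_t)` of a vertex chosen uniformly at random: for
all `n ≥ 1` and `j`, `P(D_t = j | ℓ(d_t) = n) = (1/n) ∑_{i=1}^n P(d_tⁱ = j | ℓ(d_t) = n)`.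
(If the event `ℓ(d_t) = n` is null, both sides are zero and nothing is required.) -/
structure IsUniformVertexInDegree {Ω : Type*} [MeasurableSpace Ω]
    (P : Measure Ω) (d : ℕ → Ω → InDegreeState) (D : ℕ → Ω → ℕ) : Prop where
  measurable : ∀ t, Measurable (D t)
  conditional : ∀ (t n j : ℕ), 1 ≤ n →
    P[{ω | D t ω = j} | {ω | (d t ω).len = n}] =
      (n : ℝ≥0∞)⁻¹ * ∑ i ∈ Finset.range n,
        P[{ω | (d t ω).entry i = j} | {ω | (d t ω).len = n}]

/-- Asymptotic equivalence of sequences: `f ∼ g` if `f(j)/g(j) → 1` as `j → ∞`. -/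
def AsympEquiv (f g : ℕ → ℝ) : Prop := Tendsto (fun j => f j / g j) atTop (𝓝 1)

/-!
Let `T j` be the proportion of vertices of in-degree at least `j`, `Z` the normalising constant of
the transition probabilities and `ℓ` the number of vertices, and use the clock whose step at time
`t` is `1 / Z`. One step of the chain changes `T (j + 1)` in mean by `1 / Z` times
`λ₂ j (T j - T (j + 1)) - μ₂ (j + 1) (T (j + 1) - T (j + 2)) + λ₁ (1_{j = 0} - T (j + 1))`,
up to an error of order `1 / (Z ℓ)` (`stepMean_entryMean_sub`, `entryMean_generator_tailIndicator`).

*Convergence.* The mean square displacement of `T j` in one step is of order `1 / (Z ℓ)` too, and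
the sum of these quantities over time has finite expectation, since `1 / ℓ` loses
`λ₁ / (Z (ℓ + 1))` in mean in each step. Hence `T j` minus its accumulated drift is a martingale
bounded in `L²` and converges almost surely (`ae_tendsto_sub_sum_drift`). As `Z` grows at most
linearly, the clock runs to infinity. So, along almost every path, the differences between `T j` and
a bounded stationary solution follow a perturbed Euler scheme of an infinite linear system, and the
upper limits of their absolute values form a bounded subsolution of the stationary system. That
system is governed by a birth-death chain with linear rates, killed at rate `λ₁`. The chain does not
explode, so the subsolution vanishes by the maximum principle, with a logarithmic barrier
(`dual_subsolution_eq_zero`, `tendsto_zero_of_dual_euler`). Thus `T j` converges almost surely to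
the stationary tail. Since the in-degree of a uniform vertex is at least `j` with probability
`E (T j)`, its law converges by dominated convergence.

*The limit.* It is the law of a linear birth-death process, started from one, at an independent
exponential time of rate `λ₁`. Changing time to the geometric parameter of that process, `p j` is
for `j ≥ 1` a constant times a geometric factor times the moment `∫₀¹ w ^ (j - 1) g w dw`, where the
`profile` `g` solves a first-order linear differential equation. Integration by parts gives the
stationary equations (`inDegreeMass_recurrence`), and the behaviour of `g` at `w = 1` gives the
asymptotics: a power of `1 - w` away from criticality, by comparison with beta integrals, and
`exp (-θ w / (1 - w))` at criticality. The mean comes from summing the stationary equations for the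
tails over the levels (`sum_mul_inDegreeMass`).
-/

/-! ### Bounded subsolutions of the dual birth-death equation -/

/-- The system is `(B - λ₁) u ≥ 0` for the generator `B` of the birth-death chain with birth rates
`μ₂ j` and death rates `λ₂ (j - 1)`. Its rates are linear, so it does not explode, and a
bounded nonnegative subsolution vanishes: the function `μ₂ / λ₁ + ∑_{i ≤ j} 1 / i` is an unbounded
supersolution, to which the maximum principle is applied. -/
theorem dual_subsolution_eq_zero {l1 l2 m2 : ℝ} (hl1 : 0 < l1) (hl2 : 0 ≤ l2) (hm2 : 0 ≤ m2)
    {u : ℕ → ℝ} {B : ℝ} (h0 : u 0 = 0) (hnn : ∀ j, 0 ≤ u j) (hB : ∀ j, u j ≤ B)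
    (h : ∀ j : ℕ, (l2 * j + m2 * (j + 1) + l1) * u (j + 1) ≤
      l2 * j * u j + m2 * (j + 1) * u (j + 2)) (j : ℕ) : u j = 0 := by
  set V : ℕ → ℝ := fun j => m2 / l1 + ∑ i ∈ Finset.range j, 1 / ((i : ℝ) + 1) with hV
  have hVC : ∀ j, m2 / l1 ≤ V j := fun j => by
    have : 0 ≤ ∑ i ∈ Finset.range j, 1 / ((i : ℝ) + 1) := Finset.sum_nonneg fun i _ => by positivity
    simp only [hV]; linarith
  have hVs : ∀ j, V (j + 1) = V j + 1 / ((j : ℝ) + 1) := fun j => by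
    simp only [hV, Finset.sum_range_succ]; ring
  have hC : 0 ≤ m2 / l1 := by positivity
  have key : ∀ ε : ℝ, 0 < ε → ∀ j, u j ≤ ε * V j := by
    intro ε hε
    by_contra! hcon
    obtain ⟨j0, hj0⟩ := hcon
    have hlim : Tendsto (fun j => u j - ε * V j) cofinite atBot := by
      rw [Nat.cofinite_eq_atTop]
      have h1 : Tendsto V atTop atTop :=
        tendsto_atTop_add_const_left _ _ Real.tendsto_sum_range_one_div_nat_succ_atTop
      have h2 : Tendsto (fun j => ε * V j) atTop atTop := h1.const_mul_atTop hε
      have h3 : Tendsto (fun j => B - ε * V j) atTop atBot := by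
        simpa [sub_eq_add_neg] using tendsto_atBot_add_const_left _ B
          (tendsto_neg_atTop_atBot.comp h2)
      exact tendsto_atBot_mono (fun j => by linarith [hB j]) h3
    obtain ⟨J, hJ⟩ := hlim.exists_forall_ge
    have hpos : 0 < u J - ε * V J := lt_of_lt_of_le (by linarith) (hJ j0)
    rcases J with _ | k
    · have : 0 ≤ ε * V 0 := mul_nonneg hε.le (hC.trans (hVC 0))
      linarith
    · set w := u (k + 1) - ε * V (k + 1) with hw
      have e1 : u k ≤ w + ε * V (k + 1) := by
        have h1 := hJ k
        have h2 : V k ≤ V (k + 1) := by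
          rw [hVs k]; have : 0 ≤ 1 / ((k : ℝ) + 1) := by positivity
          linarith
        have := mul_le_mul_of_nonneg_left h2 hε.le
        linarith
      have e2 : ((k : ℝ) + 1) * u (k + 2) ≤ (k + 1) * (w + ε * V (k + 1)) + ε := by
        have h1 := hJ (k + 2)
        have h2 := hVs (k + 1)
        have h3 : ((k : ℝ) + 1) * (1 / (((k + 1 : ℕ) : ℝ) + 1)) ≤ 1 := by
          push_cast; rw [mul_one_div, div_le_one (by positivity)]; linarith
        have h4 : u (k + 2) ≤ w + ε * V (k + 1) + ε * (1 / (((k + 1 : ℕ) : ℝ) + 1)) := by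
          have : V (k + 2) = V (k + 1) + 1 / (((k + 1 : ℕ) : ℝ) + 1) := h2
          rw [this] at h1; linarith
        have h5 := mul_le_mul_of_nonneg_left h4 (by positivity : (0 : ℝ) ≤ (k : ℝ) + 1)
        have h6 := mul_le_mul_of_nonneg_left h3 hε.le
        linarith
      have e3 := h k
      have e4 := mul_le_mul_of_nonneg_left e1 (by positivity : 0 ≤ l2 * k)
      have e5 := mul_le_mul_of_nonneg_left e2 hm2
      have e6 : m2 ≤ l1 * V (k + 1) := by
        have := mul_le_mul_of_nonneg_left (hVC (k + 1)) hl1.le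
        rwa [mul_div_cancel₀ _ hl1.ne'] at this
      have e7 := mul_le_mul_of_nonneg_left e6 hε.le
      have e8 : u (k + 1) = w + ε * V (k + 1) := by rw [hw]; ring
      rw [e8] at e3
      have : l1 * w ≤ 0 := by linarith
      nlinarith
  refine le_antisymm ?_ (hnn j)
  refine le_of_forall_pos_le_add fun δ hδ => ?_
  have hVj : 0 ≤ V j := hC.trans (hVC j)
  have := key (δ / (V j + 1)) (by positivity) j
  have h2 : δ / (V j + 1) * V j ≤ δ := by
    rw [div_mul_eq_mul_div, div_le_iff₀ (by positivity)]; nlinarith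
  linarith

/-! ### Stochastic approximation along a path -/

/-- Up to a convergent perturbation, `y` follows the Euler scheme of `y' = b - κ y` with step sizes
`a`, which are null and not summable. Then `limsup κ |y| ≤ limsup |b|`. -/
theorem eventually_abs_le_of_euler {a y b : ℕ → ℝ} {κ β ε : ℝ} (hκ : 0 < κ) (ha : ∀ t, 0 ≤ a t)
    (ha0 : Tendsto a atTop (𝓝 0))
    (hsum : Tendsto (fun t => ∑ s ∈ Finset.range t, a s) atTop atTop)
    (hc : ∃ c, Tendsto (fun t => y t - ∑ s ∈ Finset.range t, a s * (b s - κ * y s)) atTop (𝓝 c))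
    (hβ : ∀ᶠ t in atTop, |b t| ≤ β) (hε : 0 < ε) : ∀ᶠ t in atTop, κ * |y t| ≤ β + ε := by
  obtain ⟨c, hc⟩ := hc
  -- `r` is the remaining perturbation; adding it to `y` gives an unperturbed scheme
  set r : ℕ → ℝ := fun t => c - (y t - ∑ s ∈ Finset.range t, a s * (b s - κ * y s)) with hr
  have hr0 : Tendsto r atTop (𝓝 0) := by simpa using hc.const_sub c
  set w : ℕ → ℝ := fun t => y t + r t with hw
  have hws : ∀ t, w (t + 1) = (1 - κ * a t) * w t + a t * (b t + κ * r t) := fun t => by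
    simp only [hw, hr, Finset.sum_range_succ]; ring
  have hrε : ∀ᶠ t in atTop, κ * |r t| ≤ ε / 4 := by
    have : Tendsto (fun t => κ * |r t|) atTop (𝓝 0) := by simpa using hr0.abs.const_mul κ
    exact this.eventually_le_const (by positivity)
  have hastep : ∀ᶠ t in atTop, κ * a t ≤ 1 := by
    have : Tendsto (fun t => κ * a t) atTop (𝓝 0) := by simpa using ha0.const_mul κ
    exact this.eventually_le_const one_pos
  obtain ⟨N, hN⟩ := eventually_atTop.1 (hrε.and (hastep.and hβ))
  set A : ℕ → ℝ := fun t => ∑ s ∈ Finset.range t, a s with hA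
  set v : ℕ → ℝ := fun t => κ * |w t| - (β + ε / 4) with hv
  have hvs : ∀ t, N ≤ t → v (t + 1) ≤ (1 - κ * a t) * v t := by
    intro t ht
    obtain ⟨h1, h2, h3⟩ := hN t ht
    have h4 : |w (t + 1)| ≤ (1 - κ * a t) * |w t| + a t * (β + ε / 4) := by
      rw [hws]
      refine (abs_add_le _ _).trans ?_
      rw [abs_mul, abs_mul, abs_of_nonneg (sub_nonneg.2 h2), abs_of_nonneg (ha t)]
      have : |b t + κ * r t| ≤ β + ε / 4 := by
        refine (abs_add_le _ _).trans ?_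
        rw [abs_mul, abs_of_pos hκ]; linarith
      have := mul_le_mul_of_nonneg_left this (ha t)
      linarith
    have := mul_le_mul_of_nonneg_left h4 hκ.le
    simp only [hv]; linarith
  have hvK : ∀ t, N ≤ t → v t ≤ max (v N) 0 * Real.exp (-κ * (A t - A N)) := by
    intro t ht
    induction t, ht using Nat.le_induction with
    | base => simp
    | succ t ht ih =>
      obtain ⟨-, h2, -⟩ := hN t ht
      have h3 : A (t + 1) = A t + a t := Finset.sum_range_succ _ _
      have h4 : Real.exp (-κ * (A (t + 1) - A N)) =
          Real.exp (-(κ * a t)) * Real.exp (-κ * (A t - A N)) := by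
        rw [← Real.exp_add, h3]; congr 1; ring
      calc v (t + 1) ≤ (1 - κ * a t) * v t := hvs t ht
        _ ≤ (1 - κ * a t) * (max (v N) 0 * Real.exp (-κ * (A t - A N))) :=
          mul_le_mul_of_nonneg_left ih (sub_nonneg.2 h2)
        _ ≤ Real.exp (-(κ * a t)) * (max (v N) 0 * Real.exp (-κ * (A t - A N))) := by
          refine mul_le_mul_of_nonneg_right ?_ (by positivity)
          linarith [Real.add_one_le_exp (-(κ * a t))]
        _ = _ := by rw [h4]; ring
  have hlim : Tendsto (fun t => max (v N) 0 * Real.exp (-κ * (A t - A N))) atTop (𝓝 0) := by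
    have h1 : Tendsto (fun t => -κ * (A t - A N)) atTop atBot :=
      (tendsto_atTop_add_const_right _ (-A N) hsum).const_mul_atTop_of_neg (by linarith)
    simpa using (Real.tendsto_exp_atBot.comp h1).const_mul (max (v N) 0)
  filter_upwards [hlim.eventually_le_const (by positivity : (0 : ℝ) < ε / 4),
    eventually_ge_atTop N] with t h1 ht
  have h2 := hvK t ht
  obtain ⟨h3, -, -⟩ := hN t ht
  have h4 : |y t| ≤ |w t| + |r t| := by
    have : y t = w t - r t := by simp [hw]
    rw [this]; exact abs_sub _ _
  have h5 := mul_le_mul_of_nonneg_left h4 hκ.le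
  simp only [hv] at h2
  linarith

/-- An infinite system of perturbed Euler schemes for the dual birth-death equation, with bounded
solution, converges to zero: the upper limits `limsup |y j|` form a bounded subsolution. -/
theorem tendsto_zero_of_dual_euler {l1 l2 m2 : ℝ} (hl1 : 0 < l1) (hl2 : 0 ≤ l2) (hm2 : 0 ≤ m2)
    {a : ℕ → ℝ} {y : ℕ → ℕ → ℝ} {B : ℝ} (ha : ∀ t, 0 ≤ a t) (ha0 : Tendsto a atTop (𝓝 0))
    (hsum : Tendsto (fun t => ∑ s ∈ Finset.range t, a s) atTop atTop)
    (hy0 : ∀ t, y 0 t = 0) (hB : ∀ j t, |y j t| ≤ B)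
    (hc : ∀ j : ℕ, ∃ c, Tendsto (fun t => y (j + 1) t - ∑ s ∈ Finset.range t, a s *
      (l2 * j * y j s + m2 * (j + 1) * y (j + 2) s - (l2 * j + m2 * (j + 1) + l1) * y (j + 1) s))
      atTop (𝓝 c)) (j : ℕ) : Tendsto (y j) atTop (𝓝 0) := by
  set u : ℕ → ℝ := fun j => limsup (fun t => |y j t|) atTop with hu
  have hbdd : ∀ j, IsBoundedUnder (· ≤ ·) atTop (fun t => |y j t|) := fun j =>
    isBoundedUnder_of ⟨B, hB j⟩
  have hcob : ∀ j, IsCoboundedUnder (· ≤ ·) atTop (fun t => |y j t|) := fun j =>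
    IsBoundedUnder.isCoboundedUnder_le (isBoundedUnder_of ⟨0, fun t => abs_nonneg (y j t)⟩)
  have hev : ∀ j δ, 0 < δ → ∀ᶠ t in atTop, |y j t| ≤ u j + δ := fun j δ hδ =>
    (eventually_lt_of_limsup_lt (by simp only [hu]; linarith) (hbdd j)).mono fun t ht => le_of_lt ht
  have hnn : ∀ j, 0 ≤ u j := fun j =>
    le_limsup_of_frequently_le (Frequently.of_forall fun t => abs_nonneg _) (hbdd j)
  have hu0 : u 0 = 0 := by simp [hu, hy0]
  have huB : ∀ j, u j ≤ B := fun j => limsup_le_of_le (hcob j) (Eventually.of_forall (hB j))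
  have hsub : ∀ j : ℕ, (l2 * j + m2 * (j + 1) + l1) * u (j + 1) ≤
      l2 * j * u j + m2 * (j + 1) * u (j + 2) := by
    intro j
    set κ := l2 * j + m2 * (j + 1) + l1 with hκdef
    have hκ : 0 < κ := by positivity
    have key : ∀ δ : ℝ, 0 < δ →
        κ * u (j + 1) ≤ l2 * j * (u j + δ) + m2 * (j + 1) * (u (j + 2) + δ) + δ := by
      intro δ hδ
      have h1 : ∀ᶠ t in atTop, |l2 * j * y j t + m2 * (j + 1) * y (j + 2) t| ≤
          l2 * j * (u j + δ) + m2 * (j + 1) * (u (j + 2) + δ) := by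
        filter_upwards [hev j δ hδ, hev (j + 2) δ hδ] with t h1 h2
        refine (abs_add_le _ _).trans ?_
        rw [abs_mul (l2 * j), abs_mul (m2 * ((j : ℝ) + 1)),
          abs_of_nonneg (by positivity : 0 ≤ l2 * j),
          abs_of_nonneg (by positivity : 0 ≤ m2 * ((j : ℝ) + 1))]
        gcongr
      have h2 := eventually_abs_le_of_euler hκ ha ha0 hsum (hc j) h1 hδ
      have h3 : u (j + 1) ≤
          (l2 * j * (u j + δ) + m2 * (j + 1) * (u (j + 2) + δ) + δ) / κ :=
        limsup_le_of_le (hcob _) (h2.mono fun t ht => by rw [le_div_iff₀' hκ]; exact ht)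
      rwa [le_div_iff₀' hκ] at h3
    have hlim : Tendsto (fun δ : ℝ => l2 * j * (u j + δ) + m2 * (j + 1) * (u (j + 2) + δ) + δ)
        (𝓝[>] 0) (𝓝 (l2 * j * u j + m2 * (j + 1) * u (j + 2))) := by
      refine tendsto_nhdsWithin_of_tendsto_nhds ?_
      refine Continuous.tendsto' (by fun_prop) _ _ (by ring)
    exact ge_of_tendsto hlim (by filter_upwards [self_mem_nhdsWithin] with δ hδ using key δ hδ)
  have huz : u j = 0 := dual_subsolution_eq_zero hl1 hl2 hm2 hu0 hnn huB hsub j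
  rw [tendsto_zero_iff_abs_tendsto_zero]
  exact tendsto_of_le_liminf_of_limsup_le
    (le_liminf_of_le (hbdd j).isCoboundedUnder_ge (Eventually.of_forall fun t => abs_nonneg _))
    huz.le (hbdd j) (isBoundedUnder_of ⟨0, fun t => abs_nonneg (y j t)⟩)

/-! ### Moments on the unit interval -/

theorem integral_pow_mul_one_sub_rpow (n : ℕ) {r : ℝ} (hr : 0 ≤ r) :
    ∫ v in (0 : ℝ)..1, v ^ n * (1 - v) ^ r =
      n.factorial / ∏ i ∈ Finset.range (n + 1), (r + 1 + i) := by
  have hcont : ∀ (m : ℕ) {s : ℝ}, 0 ≤ s → Continuous fun v : ℝ => v ^ m * (1 - v) ^ s :=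
    fun m s hs => (continuous_pow m).mul
      ((continuous_const.sub continuous_id).rpow_const fun _ => Or.inr hs)
  induction n generalizing r with
  | zero =>
    have h := intervalIntegral.integral_comp_sub_left (fun v : ℝ => v ^ r) (a := 0) (b := 1) 1
    simp only [pow_zero, one_mul]
    rw [h]
    simp [integral_rpow (Or.inl (by linarith : -1 < r)), Real.zero_rpow (by linarith : r + 1 ≠ 0)]
  | succ n ih =>
    -- integration by parts moves one power of `v` to the other factor
    have hderiv : ∀ v ∈ Set.Ioo (0 : ℝ) 1,
        HasDerivAt (fun v : ℝ => v ^ (n + 1) * (1 - v) ^ (r + 1))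
          ((n + 1) * (v ^ n * (1 - v) ^ (r + 1)) - (r + 1) * (v ^ (n + 1) * (1 - v) ^ r)) v := by
      intro v hv
      have h1 : HasDerivAt (fun v : ℝ => 1 - v) (-1) v := by
        simpa using (hasDerivAt_id v).const_sub 1
      have h2 := h1.rpow_const (p := r + 1) (Or.inl (by linarith [hv.2]))
      have h3 := (hasDerivAt_pow (n + 1) v).mul h2
      refine h3.congr_deriv ?_
      have : r + 1 - 1 = r := by ring
      rw [this]; push_cast; ring
    have hint : IntervalIntegrable (fun v : ℝ => (n + 1) * (v ^ n * (1 - v) ^ (r + 1)) -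
        (r + 1) * (v ^ (n + 1) * (1 - v) ^ r)) volume 0 1 :=
      (((hcont n (by linarith)).const_mul _).sub ((hcont (n + 1) hr).const_mul
        _)).intervalIntegrable _ _
    have h := intervalIntegral.integral_eq_sub_of_hasDerivAt_of_le zero_le_one
      (hcont (n + 1) (by linarith : 0 ≤ r + 1)).continuousOn hderiv hint
    rw [intervalIntegral.integral_sub
      ((hcont n (by linarith)).const_mul _ |>.intervalIntegrable _ _)
      ((hcont (n + 1) hr).const_mul _ |>.intervalIntegrable _ _),
      intervalIntegral.integral_const_mul, intervalIntegral.integral_const_mul,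
      ih (by linarith : 0 ≤ r + 1)] at h
    simp only [sub_self, Real.zero_rpow (by linarith : r + 1 ≠ 0), mul_zero, ne_eq,
      Nat.add_eq_zero_iff, one_ne_zero, and_false, not_false_eq_true, zero_pow, zero_mul] at h
    rw [Finset.prod_range_succ']
    have hp : ∏ i ∈ Finset.range (n + 1), (r + 1 + ((i + 1 : ℕ) : ℝ)) =
        ∏ i ∈ Finset.range (n + 1), (r + 1 + 1 + (i : ℝ)) :=
      Finset.prod_congr rfl fun i _ => by push_cast; ring
    rw [hp, Nat.factorial_succ]
    have hP : (0 : ℝ) < ∏ i ∈ Finset.range (n + 1), (r + 1 + 1 + (i : ℝ)) :=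
      Finset.prod_pos fun i _ => by positivity
    have hr1 : (0 : ℝ) < r + 1 := by linarith
    generalize (∫ v in (0 : ℝ)..1, v ^ (n + 1) * (1 - v) ^ r) = X at *
    generalize (∏ i ∈ Finset.range (n + 1), (r + 1 + 1 + (i : ℝ))) = Y at *
    push_cast
    field_simp at h ⊢
    linarith

theorem tendsto_rpow_mul_integral {r : ℝ} (hr : 0 ≤ r) :
    Tendsto (fun n : ℕ => (n : ℝ) ^ (r + 1) * ∫ v in (0 : ℝ)..1, v ^ n * (1 - v) ^ r) atTop
      (𝓝 (Real.Gamma (r + 1))) := by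
  refine (Real.GammaSeq_tendsto_Gamma (r + 1)).congr fun n => ?_
  rw [integral_pow_mul_one_sub_rpow n hr, Real.GammaSeq, mul_div_assoc]

/-- Only the value at `1` of a Lipschitz weight `k` matters for the asymptotics of moments. -/
theorem tendsto_rpow_mul_integral_weight {r K : ℝ} (hr : 0 ≤ r) {k : ℝ → ℝ}
    (hk : ContinuousOn k (Set.Icc 0 1)) (hK : ∀ v ∈ Set.Icc (0 : ℝ) 1, |k v - k 1| ≤ K * (1 - v)) :
    Tendsto (fun n : ℕ => ((n : ℝ) + 1) ^ (r + 1) *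
      ∫ v in (0 : ℝ)..1, v ^ n * ((1 - v) ^ r * k v)) atTop (𝓝 (k 1 * Real.Gamma (r + 1))) := by
  have hcont : ∀ (m : ℕ) {s : ℝ}, 0 ≤ s → Continuous fun v : ℝ => v ^ m * (1 - v) ^ s :=
    fun m s hs => (continuous_pow m).mul
      ((continuous_const.sub continuous_id).rpow_const fun _ => Or.inr hs)
  have hki : ∀ n : ℕ, IntervalIntegrable (fun v : ℝ => v ^ n * (1 - v) ^ r * k v) volume 0 1 :=
    fun n => ContinuousOn.intervalIntegrable <| by
      rw [Set.uIcc_of_le zero_le_one]; exact (hcont n hr).continuousOn.mul hk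
  set E : ℕ → ℝ := fun n => (n : ℝ) ^ (r + 1) *
    ∫ v in (0 : ℝ)..1, v ^ n * (1 - v) ^ r * (k v - k 1) with hE
  have hE0 : Tendsto E atTop (𝓝 0) := by
    have hlim : Tendsto (fun n : ℕ => K * (((n : ℝ))⁻¹ *
        ((n : ℝ) ^ (r + 1 + 1) * ∫ v in (0 : ℝ)..1, v ^ n * (1 - v) ^ (r + 1)))) atTop (𝓝 0) := by
      have h := (tendsto_inv_atTop_nhds_zero_nat (𝕜 := ℝ)).mul
        (tendsto_rpow_mul_integral (by linarith : 0 ≤ r + 1))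
      simpa using h.const_mul K
    refine squeeze_zero_norm' ?_ hlim
    filter_upwards [eventually_gt_atTop 0] with n hn
    have hn' : (0 : ℝ) < n := by exact_mod_cast hn
    have hb : |∫ v in (0 : ℝ)..1, v ^ n * (1 - v) ^ r * (k v - k 1)| ≤
        ∫ v in (0 : ℝ)..1, K * (v ^ n * (1 - v) ^ (r + 1)) := by
      have hi : IntervalIntegrable (fun v : ℝ => K * (v ^ n * (1 - v) ^ (r + 1))) volume 0 1 :=
        ((hcont n (by linarith : 0 ≤ r + 1)).const_mul K).intervalIntegrable 0 1
      rw [← Real.norm_eq_abs]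
      refine intervalIntegral.norm_integral_le_of_norm_le zero_le_one ?_ hi
      refine Eventually.of_forall fun v hv => ?_
      have h1 : 0 ≤ 1 - v := by linarith [hv.2]
      rw [Real.norm_eq_abs, abs_mul, abs_of_nonneg (mul_nonneg (pow_nonneg hv.1.le n)
        (Real.rpow_nonneg h1 r)), Real.rpow_add_one' h1 (by linarith)]
      have := mul_le_mul_of_nonneg_left (hK v ⟨hv.1.le, hv.2⟩)
        (mul_nonneg (pow_nonneg hv.1.le n) (Real.rpow_nonneg h1 r))
      linarith
    rw [intervalIntegral.integral_const_mul] at hb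
    rw [Real.norm_eq_abs, hE]
    simp only
    rw [abs_mul, abs_of_nonneg (by positivity : 0 ≤ (n : ℝ) ^ (r + 1)),
      Real.rpow_add_one hn'.ne' (r + 1)]
    calc _ ≤ (n : ℝ) ^ (r + 1) * (K * ∫ v in (0 : ℝ)..1, v ^ n * (1 - v) ^ (r + 1)) := by gcongr
      _ = _ := by field_simp
  have hratio : Tendsto (fun n : ℕ => (((n : ℝ) + 1) / n) ^ (r + 1)) atTop (𝓝 1) := by
    have h1 : Tendsto (fun n : ℕ => ((n : ℝ) + 1) / n) atTop (𝓝 1) := by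
      have h2 : Tendsto (fun n : ℕ => 1 + ((n : ℝ))⁻¹) atTop (𝓝 1) := by
        simpa using (tendsto_inv_atTop_nhds_zero_nat (𝕜 := ℝ)).const_add 1
      refine h2.congr' ?_
      filter_upwards [eventually_gt_atTop 0] with n hn
      have hn' : (0 : ℝ) < n := by exact_mod_cast hn
      field_simp
    simpa using h1.rpow_const (p := r + 1) (Or.inl one_ne_zero)
  have hmain := hratio.mul (hE0.add ((tendsto_rpow_mul_integral hr).const_mul (k 1)))
  rw [zero_add, one_mul] at hmain
  refine hmain.congr' ?_
  filter_upwards [eventually_gt_atTop 0] with n hn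
  have hn' : (0 : ℝ) < n := by exact_mod_cast hn
  have h1 : ∫ v in (0 : ℝ)..1, v ^ n * (1 - v) ^ r * (k v - k 1) =
      (∫ v in (0 : ℝ)..1, v ^ n * ((1 - v) ^ r * k v)) -
        k 1 * ∫ v in (0 : ℝ)..1, v ^ n * (1 - v) ^ r := by
    rw [← intervalIntegral.integral_const_mul, ← intervalIntegral.integral_sub]
    · congr 1; ext v; ring
    · simpa only [mul_assoc] using hki n
    · exact ((hcont n hr).const_mul _).intervalIntegrable _ _
  rw [hE]
  simp only
  rw [h1, Real.div_rpow (by positivity) hn'.le]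
  have : (0 : ℝ) < (n : ℝ) ^ (r + 1) := by positivity
  field_simp
  ring

/-! ### The Laplace-transformed birth-death profile -/

/-- In the time scale `w` of the geometric parameter of a linear birth-death process, divided by its
limiting value, `profile q θ` is the probability that an independent exponential clock has not yet
rung. It solves `g' = - θ g / ((1 - w) (1 - q w))`, `g 0 = 1`. Here `q ≤ 1` is the ratio of the
smaller to the larger of the birth and death rates, and `θ` that of the rate of the clock to the
larger one. For `q = 1` the value at `w = 1` is a junk value and plays no role. -/
noncomputable def profile (q θ w : ℝ) : ℝ :=
  if q = 1 then Real.exp (-(θ * (w / (1 - w)))) else ((1 - w) / (1 - q * w)) ^ (θ / (1 - q))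

section Profile

variable {q θ : ℝ}

theorem profile_zero : profile q θ 0 = 1 := by
  unfold profile; split_ifs <;> simp

theorem profile_nonneg (hq1 : q ≤ 1) {w : ℝ} (hw : w ∈ Set.Icc (0 : ℝ) 1) :
    0 ≤ profile q θ w := by
  unfold profile
  split_ifs
  · positivity
  · refine Real.rpow_nonneg (div_nonneg (by linarith [hw.2]) ?_) _
    nlinarith [hw.1, hw.2]

theorem profile_le_one (hq1 : q ≤ 1) (hθ : 0 ≤ θ) {w : ℝ} (hw : w ∈ Set.Icc (0 : ℝ) 1) :
    profile q θ w ≤ 1 := by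
  have hw1 : 0 ≤ 1 - w := by linarith [hw.2]
  unfold profile
  split_ifs with h
  · rw [Real.exp_le_one_iff, neg_nonpos]
    exact mul_nonneg hθ (div_nonneg hw.1 hw1)
  · have hq : q < 1 := lt_of_le_of_ne hq1 h
    have h0 : 0 ≤ 1 - q * w := by nlinarith [hw.1, hw.2]
    refine Real.rpow_le_one (div_nonneg hw1 h0) (div_le_one_of_le₀ ?_ h0)
      (div_nonneg hθ (by linarith))
    nlinarith [hw.1]

theorem hasDerivAt_profile (hq1 : q ≤ 1) {w : ℝ} (hw0 : 0 ≤ w) (hw1 : w < 1) :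
    HasDerivAt (profile q θ) (-(θ * profile q θ w / ((1 - w) * (1 - q * w)))) w := by
  have h1w : 0 < 1 - w := by linarith
  have hqw : 0 < 1 - q * w := by nlinarith
  have hd : HasDerivAt (fun w : ℝ => 1 - w) (-1) w := by
    simpa using (hasDerivAt_id w).const_sub 1
  by_cases h : q = 1
  · have he : profile q θ = fun w => Real.exp (-(θ * (w / (1 - w)))) := by
      ext w; simp [profile, h]
    rw [he]
    have := ((((hasDerivAt_id w).div hd h1w.ne').const_mul θ).neg).exp
    refine this.congr_deriv ?_
    simp only [h, id, Pi.div_apply, Pi.neg_apply]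
    field_simp
    ring
  · have hq : q < 1 := lt_of_le_of_ne hq1 h
    have he : profile q θ = fun w => ((1 - w) / (1 - q * w)) ^ (θ / (1 - q)) := by
      ext w; simp [profile, h]
    rw [he]
    have hd2 : HasDerivAt (fun w : ℝ => 1 - q * w) (-q) w := by
      simpa using ((hasDerivAt_id w).const_mul q).const_sub 1
    have hpos : 0 < (1 - w) / (1 - q * w) := div_pos h1w hqw
    have := (hd.div hd2 hqw.ne').rpow_const (p := θ / (1 - q)) (Or.inl hpos.ne')
    refine this.congr_deriv ?_
    simp only [Pi.div_apply]
    rw [Real.rpow_sub_one hpos.ne']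
    have : 1 - q ≠ 0 := by linarith
    field_simp
    ring

theorem intervalIntegrable_pow_mul_profile (hq1 : q ≤ 1) (hθ : 0 ≤ θ) (n : ℕ) :
    IntervalIntegrable (fun w => w ^ n * profile q θ w) volume 0 1 := by
  rw [intervalIntegrable_iff_integrableOn_Ioo_of_le zero_le_one]
  refine Integrable.of_bound ?_ 1 ?_
  · have hc : ContinuousOn (fun w => w ^ n * profile q θ w) (Set.Ioo 0 1) := fun w hw =>
       ((continuous_pow n).continuousAt.mul
        (hasDerivAt_profile hq1 hw.1.le hw.2).continuousAt).continuousWithinAt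
    exact hc.aestronglyMeasurable measurableSet_Ioo
  · refine ae_restrict_of_forall_mem measurableSet_Ioo fun w hw => ?_
    have hw' := Set.Ioo_subset_Icc_self hw
    rw [Real.norm_eq_abs, abs_of_nonneg (mul_nonneg (pow_nonneg hw.1.le n)
      (profile_nonneg hq1 hw'))]
    exact mul_le_one₀ (pow_le_one₀ hw.1.le hw.2.le) (profile_nonneg hq1 hw')
      (profile_le_one hq1 hθ hw')

/-- Integration by parts turns the differential equation of the profile into the three-term
recurrence of the stationary in-degree distribution. -/
theorem integral_profile_recurrence (hq0 : 0 ≤ q) (hq1 : q ≤ 1) (hθ : 0 ≤ θ) (n : ℕ) :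
    n * (∫ w in (0 : ℝ)..1, w ^ (n - 1) * profile q θ w) -
      (1 + q) * (n + 1) * (∫ w in (0 : ℝ)..1, w ^ n * profile q θ w) +
      q * (n + 2) * (∫ w in (0 : ℝ)..1, w ^ (n + 1) * profile q θ w) -
      θ * (∫ w in (0 : ℝ)..1, w ^ n * profile q θ w) = if n = 0 then -1 else 0 := by
  have hI := intervalIntegrable_pow_mul_profile (q := q) (θ := θ) hq1 hθ
  have hderiv : ∀ w ∈ Set.Ioo (0 : ℝ) 1,
      HasDerivAt (fun w => ((1 - w) * (1 - q * w) * w ^ n) * profile q θ w)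
        (n * (w ^ (n - 1) * profile q θ w) - (1 + q) * (n + 1) * (w ^ n * profile q θ w) +
          q * (n + 2) * (w ^ (n + 1) * profile q θ w) - θ * (w ^ n * profile q θ w)) w := by
    intro w hw
    have h1w : 0 < 1 - w := by linarith [hw.2]
    have hqw : 0 < 1 - q * w := by nlinarith [hw.1, hw.2]
    have hd : HasDerivAt (fun w : ℝ => 1 - w) (-1) w := by
      simpa using (hasDerivAt_id w).const_sub 1
    have hd2 : HasDerivAt (fun w : ℝ => 1 - q * w) (-q) w := by
      simpa using ((hasDerivAt_id w).const_mul q).const_sub 1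
    have := ((hd.mul hd2).mul (hasDerivAt_pow n w)).mul
      (hasDerivAt_profile (θ := θ) hq1 hw.1.le hw.2)
    refine this.congr_deriv ?_
    simp only [Pi.mul_apply]
    rcases n with _ | n
    · simp; field_simp; ring
    · push_cast
      field_simp
      ring
  have hbound : ∀ w ∈ Set.Ioo (0 : ℝ) 1,
      |((1 - w) * (1 - q * w) * w ^ n) * profile q θ w| ≤ 1 - w := by
    intro w hw
    have hw' := Set.Ioo_subset_Icc_self hw
    have h1w : 0 ≤ 1 - w := by linarith [hw.2]
    have hqw : 0 ≤ 1 - q * w := by nlinarith [hw.1, hw.2]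
    have hqw1 : 1 - q * w ≤ 1 := by nlinarith [hw.1, hw.2]
    have hp := pow_nonneg hw.1.le n
    have hp1 := pow_le_one₀ (n := n) hw.1.le hw.2.le
    have hg := profile_nonneg (θ := θ) hq1 hw'
    have hg1 := profile_le_one (θ := θ) hq1 hθ hw'
    rw [abs_of_nonneg (by positivity)]
    calc (1 - w) * (1 - q * w) * w ^ n * profile q θ w ≤ (1 - w) * 1 * 1 * 1 := by gcongr
      _ = 1 - w := by ring
  have h := intervalIntegral.integral_eq_sub_of_hasDerivAt_of_tendsto zero_lt_one
    (fa := if n = 0 then 1 else 0) (fb := 0) hderiv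
    (((((hI (n - 1)).const_mul _).sub ((hI n).const_mul _)).add ((hI (n + 1)).const_mul _)).sub
      ((hI n).const_mul _)) ?_ ?_
  · rw [intervalIntegral.integral_sub ((((hI (n - 1)).const_mul _).sub ((hI n).const_mul _)).add
        ((hI (n + 1)).const_mul _)) ((hI n).const_mul _),
      intervalIntegral.integral_add (((hI (n - 1)).const_mul _).sub ((hI n).const_mul _))
        ((hI (n + 1)).const_mul _),
      intervalIntegral.integral_sub ((hI (n - 1)).const_mul _) ((hI n).const_mul _)] at h
    simp only [intervalIntegral.integral_const_mul] at h
    rw [h]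
    split_ifs <;> simp
  · have hc : ContinuousAt (fun w => ((1 - w) * (1 - q * w) * w ^ n) * profile q θ w) 0 :=
      ContinuousAt.mul (by fun_prop) (hasDerivAt_profile hq1 le_rfl one_pos).continuousAt
    have h0 : ((1 - (0 : ℝ)) * (1 - q * 0) * 0 ^ n) * profile q θ 0 = if n = 0 then 1 else 0 := by
      rw [profile_zero]; rcases n with _ | n <;> simp
    rw [← h0]
    exact hc.tendsto.mono_left nhdsWithin_le_nhds
  · have hlim : Tendsto (fun w : ℝ => 1 - w) (𝓝[<] 1) (𝓝 0) :=
      tendsto_nhdsWithin_of_tendsto_nhds (Continuous.tendsto' (by fun_prop) _ _ (by ring))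
    refine squeeze_zero_norm' ?_ hlim
    filter_upwards [Ioo_mem_nhdsLT zero_lt_one] with w hw using hbound w hw

theorem integral_profile_nonneg (hq1 : q ≤ 1) (n : ℕ) :
    0 ≤ ∫ w in (0 : ℝ)..1, w ^ n * profile q θ w :=
  intervalIntegral.integral_nonneg zero_le_one fun _ hw =>
    mul_nonneg (pow_nonneg hw.1 n) (profile_nonneg hq1 hw)

theorem tendsto_rpow_mul_integral_profile (hq0 : 0 ≤ q) (hq1 : q < 1) (hθ : 0 ≤ θ) :
    Tendsto (fun n : ℕ => ((n : ℝ) + 1) ^ (θ / (1 - q) + 1) *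
      ∫ w in (0 : ℝ)..1, w ^ n * profile q θ w) atTop
      (𝓝 ((1 - q) ^ (-(θ / (1 - q))) * Real.Gamma (θ / (1 - q) + 1))) := by
  set r := θ / (1 - q) with hrdef
  have hr : 0 ≤ r := div_nonneg hθ (by linarith)
  have hpos : ∀ v ∈ Set.Icc (0 : ℝ) 1, 0 < 1 - q * v := fun v hv => by nlinarith [hv.1, hv.2]
  set k : ℝ → ℝ := fun v => (1 - q * v) ^ (-r) with hk
  have hd : ∀ v ∈ Set.Icc (0 : ℝ) 1, HasDerivAt k (-q * (-r) * (1 - q * v) ^ (-r - 1)) v := by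
    intro v hv
    have hd2 : HasDerivAt (fun w : ℝ => 1 - q * w) (-q) v := by
      simpa using ((hasDerivAt_id v).const_mul q).const_sub 1
    exact hd2.rpow_const (Or.inl (hpos v hv).ne')
  have hK : ∀ v ∈ Set.Icc (0 : ℝ) 1, |k v - k 1| ≤ q * r * (1 - q) ^ (-r - 1) * (1 - v) := by
    intro v hv
    have := (convex_Icc (0 : ℝ) 1).norm_image_sub_le_of_norm_hasDerivWithin_le (f := k)
      (C := q * r * (1 - q) ^ (-r - 1)) (fun x hx => (hd x hx).hasDerivWithinAt) ?_
      (Set.right_mem_Icc.2 zero_le_one) hv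
    · rw [Real.norm_eq_abs, Real.norm_eq_abs, abs_sub_comm v 1,
        abs_of_nonneg (by linarith [hv.2] : 0 ≤ 1 - v)] at this
      exact this
    · intro x hx
      have h1 := Real.rpow_nonneg (hpos x hx).le (-r - 1)
      rw [Real.norm_eq_abs, show -q * -r * (1 - q * x) ^ (-r - 1) =
        q * r * (1 - q * x) ^ (-r - 1) by ring, abs_of_nonneg (by positivity)]
      have : (1 - q * x) ^ (-r - 1) ≤ (1 - q) ^ (-r - 1) :=
        Real.rpow_le_rpow_of_nonpos (by linarith) (by nlinarith [hx.2]) (by linarith)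
      gcongr
  have h := tendsto_rpow_mul_integral_weight hr
    (fun v hv => (hd v hv).continuousAt.continuousWithinAt) hK
  have hk1 : k 1 = (1 - q) ^ (-r) := by simp [hk]
  rw [hk1] at h
  refine h.congr fun n => ?_
  congr 1
  refine intervalIntegral.integral_congr fun v hv => ?_
  rw [Set.uIcc_of_le zero_le_one] at hv
  simp only [profile, if_neg hq1.ne, hk]
  rw [Real.div_rpow (by linarith [hv.2]) (hpos v hv).le, Real.rpow_neg (hpos v hv).le,
    div_eq_mul_inv]

theorem tendsto_pow_mul_integral_profile_critical (hθ : 0 < θ) (m : ℕ) :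
    Tendsto (fun n : ℕ => ((n : ℝ) + 1) ^ m * ∫ w in (0 : ℝ)..1, w ^ n * profile 1 θ w) atTop
      (𝓝 0) := by
  set C : ℝ := Real.exp θ * m.factorial / θ ^ m with hC
  -- the profile vanishes to every order at the right endpoint
  have hle : ∀ w ∈ Set.Ioo (0 : ℝ) 1, profile 1 θ w ≤ C * (1 - w) ^ (m : ℝ) := by
    intro w hw
    have h1w : 0 < 1 - w := by linarith [hw.2]
    have h1 := Real.pow_div_factorial_le_exp (θ / (1 - w)) (by positivity) m
    have h2 : profile 1 θ w = Real.exp θ * (Real.exp (θ / (1 - w)))⁻¹ := by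
      rw [← Real.exp_neg, ← Real.exp_add, profile, if_pos rfl]
      congr 1; field_simp; ring
    rw [h2, hC, Real.rpow_natCast]
    have h3 : (Real.exp (θ / (1 - w)))⁻¹ ≤ ((θ / (1 - w)) ^ m / m.factorial)⁻¹ :=
      inv_anti₀ (by positivity) h1
    calc _ ≤ Real.exp θ * ((θ / (1 - w)) ^ m / m.factorial)⁻¹ := by gcongr
      _ = _ := by rw [div_pow]; field_simp
  have hcont : ∀ n : ℕ, Continuous fun v : ℝ => v ^ n * (1 - v) ^ (m : ℝ) := fun n =>
    (continuous_pow n).mul ((continuous_const.sub continuous_id).rpow_const fun _ =>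
      Or.inr (by positivity))
  have hint : ∀ n : ℕ, ∫ w in (0 : ℝ)..1, w ^ n * profile 1 θ w ≤
      C * ∫ w in (0 : ℝ)..1, w ^ n * (1 - w) ^ (m : ℝ) := by
    intro n
    rw [← intervalIntegral.integral_const_mul]
    refine intervalIntegral.integral_mono_on_of_le_Ioo zero_le_one
      (intervalIntegrable_pow_mul_profile le_rfl hθ.le n)
      (((hcont n).const_mul _).intervalIntegrable _ _) fun w hw => ?_
    have := mul_le_mul_of_nonneg_left (hle w hw) (pow_nonneg hw.1.le n)
    linarith
  have h := tendsto_rpow_mul_integral_weight (r := m) (K := 0) (k := fun _ => 1) (by positivity)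
    continuousOn_const (by simp)
  simp only [mul_one, one_mul] at h
  have h2 : Tendsto (fun n : ℕ => C * ((((n : ℝ) + 1))⁻¹ * (((n : ℝ) + 1) ^ ((m : ℝ) + 1) *
      ∫ w in (0 : ℝ)..1, w ^ n * (1 - w) ^ (m : ℝ)))) atTop (𝓝 0) := by
    have h3 : Tendsto (fun n : ℕ => (((n : ℝ) + 1))⁻¹) atTop (𝓝 0) :=
      tendsto_inv_atTop_zero.comp (tendsto_natCast_atTop_atTop.atTop_add tendsto_const_nhds)
    simpa using (h3.mul h).const_mul C
  refine squeeze_zero (fun n => mul_nonneg (by positivity) (integral_profile_nonneg le_rfl n))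
    (fun n => ?_) h2
  calc ((n : ℝ) + 1) ^ m * ∫ w in (0 : ℝ)..1, w ^ n * profile 1 θ w
      ≤ ((n : ℝ) + 1) ^ m * (C * ∫ w in (0 : ℝ)..1, w ^ n * (1 - w) ^ (m : ℝ)) := by
        gcongr; exact hint n
    _ = _ := by
        rw [Real.rpow_add_one (by positivity), Real.rpow_natCast]; field_simp

theorem exists_mul_pow_le_integral_profile_critical (hθ : 0 ≤ θ) {a : ℝ} (ha0 : 0 < a)
    (ha1 : a < 1) : ∃ c > 0, ∀ n : ℕ, c * a ^ n ≤ ∫ w in (0 : ℝ)..1, w ^ n * profile 1 θ w := by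
  set b := (a + 1) / 2 with hb
  have hab : a < b := by rw [hb]; linarith
  have hb1 : b < 1 := by rw [hb]; linarith
  refine ⟨(b - a) * Real.exp (-(θ / (1 - b))), mul_pos (by linarith) (Real.exp_pos _),
    fun n => ?_⟩
  have hI := intervalIntegrable_pow_mul_profile (q := 1) (θ := θ) le_rfl hθ n
  have hsub : Set.uIcc a b ⊆ Set.uIcc (0 : ℝ) 1 := by
    rw [Set.uIcc_of_le hab.le, Set.uIcc_of_le zero_le_one]
    exact Set.Icc_subset_Icc ha0.le hb1.le
  calc (b - a) * Real.exp (-(θ / (1 - b))) * a ^ n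
      = ∫ _ in a..b, a ^ n * Real.exp (-(θ / (1 - b))) := by
        rw [intervalIntegral.integral_const, smul_eq_mul]; ring
    _ ≤ ∫ w in a..b, w ^ n * profile 1 θ w := by
        refine intervalIntegral.integral_mono_on hab.le (by simp) (hI.mono_set hsub) fun w hw => ?_
        have h1w : 0 < 1 - w := by linarith [hw.2]
        have h1b : 0 < 1 - b := by linarith
        rw [profile, if_pos rfl]
        have h1 : w / (1 - w) ≤ 1 / (1 - b) := by
          apply div_le_div₀ <;> linarith [hw.2]
        have h2 : θ * (w / (1 - w)) ≤ θ / (1 - b) := by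
          have := mul_le_mul_of_nonneg_left h1 hθ
          rwa [mul_one_div] at this
        have h3 : a ^ n ≤ w ^ n := pow_le_pow_left₀ ha0.le hw.1 n
        have h4 : 0 ≤ w ^ n := pow_nonneg (ha0.le.trans hw.1) n
        gcongr
    _ ≤ ∫ w in (0 : ℝ)..1, w ^ n * profile 1 θ w := by
        refine intervalIntegral.integral_mono_interval ha0.le hab.le hb1.le ?_ hI
        refine ae_restrict_of_forall_mem measurableSet_Ioc fun w hw => ?_
        exact mul_nonneg (pow_nonneg hw.1.le n) (profile_nonneg le_rfl ⟨hw.1.le, hw.2⟩)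

end Profile

/-! ### The stationary in-degree distribution -/

/-- The limiting mass of the in-degree `j ≥ 1` (the value at `j = 0` plays no role). It is
`∫₀^∞ λ₁ exp (-λ₁ s) P(Z_s = j) ds` for the linear birth-death process `Z` started from one,
written in the time scale in which the geometric parameter of `Z_s` grows linearly. -/
noncomputable def inDegreeMass (l1 l2 m2 : ℝ) (j : ℕ) : ℝ :=
  if m2 ≤ l2 then l1 / l2 * ∫ w in (0 : ℝ)..1, w ^ (j - 1) * profile (m2 / l2) (l1 / l2) w
  else l1 / l2 * (l2 / m2) ^ j * ∫ w in (0 : ℝ)..1, w ^ (j - 1) * profile (l2 / m2) (l1 / m2) w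

/-- The limiting probability of an in-degree of at least `j`. -/
noncomputable def inDegreeTail (l1 l2 m2 : ℝ) : ℕ → ℝ
  | 0 => 1
  | j + 1 => (if j = 0 then 1 else 0) +
      (l2 * j * inDegreeMass l1 l2 m2 j - m2 * (j + 1) * inDegreeMass l1 l2 m2 (j + 1)) / l1

theorem asympEquiv_of_tendsto {f h : ℕ → ℝ} {c r κ C : ℝ} (hC : C ≠ 0) (hκ : κ ≠ 0)
    {g X : ℕ → ℝ} (hX : Tendsto (fun n : ℕ => ((n : ℝ) + 1) ^ (r + 1) * X n) atTop (𝓝 C))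
    (hg : ∀ n, g n ≠ 0) (hf : ∀ n, f (n + 1) = κ * g n * X n)
    (hc : ∀ n, c * h (n + 1) = κ * C * g n) :
    AsympEquiv f (fun j => c * h j * (j : ℝ) ^ (-(1 + r))) := by
  unfold AsympEquiv
  rw [← tendsto_add_atTop_iff_nat 1]
  have h1 : Tendsto (fun n : ℕ => ((n : ℝ) + 1) ^ (r + 1) * X n / C) atTop (𝓝 1) := by
    simpa [hC] using hX.div_const C
  refine h1.congr fun n => ?_
  simp only [hf, hc]
  rw [Nat.cast_add, Nat.cast_one, Real.rpow_neg (by positivity), add_comm 1 r]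
  have : ((n : ℝ) + 1) ^ (r + 1) ≠ 0 := by positivity
  have := hg n
  field_simp

theorem tendsto_mul_zero_of_tendsto_rpow {r C : ℝ} (hr : 0 < r) {X : ℕ → ℝ}
    (hX : Tendsto (fun n : ℕ => ((n : ℝ) + 1) ^ (r + 1) * X n) atTop (𝓝 C)) :
    Tendsto (fun n : ℕ => ((n : ℝ) + 1) * X n) atTop (𝓝 0) := by
  have h1 : Tendsto (fun n : ℕ => ((n : ℝ) + 1) ^ (-r)) atTop (𝓝 0) :=
    (tendsto_rpow_neg_atTop hr).comp (tendsto_natCast_atTop_atTop.atTop_add tendsto_const_nhds)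
  have h2 := h1.mul hX
  rw [zero_mul] at h2
  refine h2.congr fun n => ?_
  rw [← mul_assoc, ← Real.rpow_add (by positivity)]
  simp

section Stationary

variable {l1 l2 m2 : ℝ}

theorem inDegreeMass_nonneg (hl1 : 0 < l1) (hl2 : 0 < l2) (hm2 : 0 ≤ m2) (j : ℕ) :
    0 ≤ inDegreeMass l1 l2 m2 j := by
  unfold inDegreeMass
  split_ifs with h
  · exact mul_nonneg (by positivity)
      (integral_profile_nonneg (div_le_one_of_le₀ h hl2.le) _)
  · exact mul_nonneg (by positivity)
      (integral_profile_nonneg (div_le_one_of_le₀ (not_le.1 h).le hm2) _)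

theorem inDegreeMass_recurrence (hl1 : 0 < l1) (hl2 : 0 < l2) (hm2 : 0 ≤ m2) (j : ℕ) :
    l2 * j * inDegreeMass l1 l2 m2 j - (l2 + m2) * (j + 1) * inDegreeMass l1 l2 m2 (j + 1) +
      m2 * (j + 2) * inDegreeMass l1 l2 m2 (j + 2) - l1 * inDegreeMass l1 l2 m2 (j + 1) =
      if j = 0 then -l1 else 0 := by
  unfold inDegreeMass
  by_cases h : m2 ≤ l2
  · have h1 := integral_profile_recurrence (q := m2 / l2) (θ := l1 / l2) (by positivity)
      (div_le_one_of_le₀ h hl2.le) (by positivity) j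
    simp only [if_pos h, Nat.add_sub_cancel, show j + 2 - 1 = j + 1 from rfl]
    have h2 : (if j = 0 then -l1 else 0) = l1 * if j = 0 then -1 else 0 := by split_ifs <;> ring
    rw [h2, ← h1]
    field_simp
  · have hm : 0 < m2 := hl2.trans (not_le.1 h)
    have h1 := integral_profile_recurrence (q := l2 / m2) (θ := l1 / m2) (by positivity)
      (div_le_one_of_le₀ (not_le.1 h).le hm2) (by positivity) j
    simp only [if_neg h, Nat.add_sub_cancel, show j + 2 - 1 = j + 1 from rfl]
    have h2 : (if j = 0 then -l1 else 0) =
        m2 * (l1 / l2) * (l2 / m2) ^ (j + 1) * if j = 0 then -1 else 0 := by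
      split_ifs with hj
      · subst hj; simp; field_simp
      · ring
    rw [h2, ← h1, pow_succ (l2 / m2) (j + 1), pow_succ]
    field_simp
    ring

theorem inDegreeMass_asymp_supercritical (hl1 : 0 < l1) (hm2 : 0 ≤ m2) (h : m2 < l2) :
    AsympEquiv (inDegreeMass l1 l2 m2) (fun j =>
      (l1 / l2 * (l2 / (l2 - m2)) ^ (l1 / (l2 - m2)) * Real.Gamma (1 + l1 / (l2 - m2))) *
        (j : ℝ) ^ (-(1 + l1 / (l2 - m2)))) := by
  have hl2 : 0 < l2 := hm2.trans_lt h
  have hd : 0 < l2 - m2 := by linarith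
  have hX := tendsto_rpow_mul_integral_profile (q := m2 / l2) (θ := l1 / l2) (by positivity)
    ((div_lt_one hl2).2 h) (by positivity)
  have hr : l1 / l2 / (1 - m2 / l2) = l1 / (l2 - m2) := by field_simp
  have hb : (1 - m2 / l2) ^ (-(l1 / (l2 - m2))) = (l2 / (l2 - m2)) ^ (l1 / (l2 - m2)) := by
    rw [show 1 - m2 / l2 = (l2 / (l2 - m2))⁻¹ by field_simp, Real.inv_rpow (by positivity),
      Real.rpow_neg (by positivity), inv_inv]
  rw [hr, hb, add_comm (l1 / (l2 - m2)) 1] at hX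
  have hG : 0 < Real.Gamma (1 + l1 / (l2 - m2)) := Real.Gamma_pos_of_pos (by positivity)
  have := asympEquiv_of_tendsto (f := inDegreeMass l1 l2 m2) (h := fun _ => 1)
    (c := l1 / l2 * (l2 / (l2 - m2)) ^ (l1 / (l2 - m2)) * Real.Gamma (1 + l1 / (l2 - m2)))
    (r := l1 / (l2 - m2)) (κ := l1 / l2) (g := fun _ => 1)
    (C := (l2 / (l2 - m2)) ^ (l1 / (l2 - m2)) * Real.Gamma (1 + l1 / (l2 - m2)))
    (by positivity) (by positivity)
    (X := fun n => ∫ w in (0 : ℝ)..1, w ^ n * profile (m2 / l2) (l1 / l2) w)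
    (by simpa only [add_comm] using hX) (fun n => one_ne_zero) (fun n => ?_) (fun n => by ring)
  · simpa only [mul_one] using this
  · rw [inDegreeMass, if_pos h.le, mul_one, Nat.add_sub_cancel]

theorem inDegreeMass_asymp_subcritical (hl1 : 0 < l1) (hl2 : 0 < l2) (h : l2 < m2) :
    AsympEquiv (inDegreeMass l1 l2 m2) (fun j =>
      (l1 * m2 / l2 ^ 2 * (m2 / (m2 - l2)) ^ (l1 / (m2 - l2)) *
        Real.Gamma (1 + l1 / (m2 - l2))) * (l2 / m2) ^ (j + 1) *
          (j : ℝ) ^ (-(1 + l1 / (m2 - l2)))) := by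
  have hm2 : 0 < m2 := hl2.trans h
  have hd : 0 < m2 - l2 := by linarith
  have hX := tendsto_rpow_mul_integral_profile (q := l2 / m2) (θ := l1 / m2) (by positivity)
    ((div_lt_one hm2).2 h) (by positivity)
  have hr : l1 / m2 / (1 - l2 / m2) = l1 / (m2 - l2) := by field_simp
  have hb : (1 - l2 / m2) ^ (-(l1 / (m2 - l2))) = (m2 / (m2 - l2)) ^ (l1 / (m2 - l2)) := by
    rw [show 1 - l2 / m2 = (m2 / (m2 - l2))⁻¹ by field_simp, Real.inv_rpow (by positivity),
      Real.rpow_neg (by positivity), inv_inv]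
  rw [hr, hb, add_comm (l1 / (m2 - l2)) 1] at hX
  have hG : 0 < Real.Gamma (1 + l1 / (m2 - l2)) := Real.Gamma_pos_of_pos (by positivity)
  refine asympEquiv_of_tendsto (h := fun j => (l2 / m2) ^ (j + 1)) (r := l1 / (m2 - l2))
    (κ := l1 / l2) (g := fun n => (l2 / m2) ^ (n + 1))
    (C := (m2 / (m2 - l2)) ^ (l1 / (m2 - l2)) * Real.Gamma (1 + l1 / (m2 - l2)))
    (X := fun n => ∫ w in (0 : ℝ)..1, w ^ n * profile (l2 / m2) (l1 / m2) w) ?_ (by positivity)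
    (by simpa only [add_comm] using hX) (fun n => by positivity) (fun n => ?_) (fun n => ?_)
  · positivity
  · rw [inDegreeMass, if_neg (not_le.2 h), Nat.add_sub_cancel]
  · rw [pow_succ (l2 / m2) (n + 1)]
    generalize Real.Gamma (1 + l1 / (m2 - l2)) = G
    field_simp

theorem inDegreeMass_critical (hl2 : 0 < l2) (n : ℕ) :
    inDegreeMass l1 l2 l2 (n + 1) =
      l1 / l2 * ∫ w in (0 : ℝ)..1, w ^ n * profile 1 (l1 / l2) w := by
  rw [inDegreeMass, if_pos le_rfl, div_self hl2.ne', Nat.add_sub_cancel]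

theorem tendsto_pow_mul_inDegreeMass_critical (hl1 : 0 < l1) (hl2 : 0 < l2) (m : ℕ) :
    Tendsto (fun j : ℕ => (j : ℝ) ^ m * inDegreeMass l1 l2 l2 j) atTop (𝓝 0) := by
  rw [← tendsto_add_atTop_iff_nat 1]
  have := (tendsto_pow_mul_integral_profile_critical (div_pos hl1 hl2) m).const_mul (l1 / l2)
  rw [mul_zero] at this
  refine this.congr fun n => ?_
  rw [inDegreeMass_critical hl2]; push_cast; ring

theorem tendsto_exp_mul_inDegreeMass_critical (hl1 : 0 < l1) (hl2 : 0 < l2) {ε : ℝ} (hε : 0 < ε) :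
    Tendsto (fun j : ℕ => Real.exp (ε * j) * inDegreeMass l1 l2 l2 j) atTop atTop := by
  rw [← tendsto_add_atTop_iff_nat 1]
  obtain ⟨c, hc, h⟩ := exists_mul_pow_le_integral_profile_critical (div_pos hl1 hl2).le
    (Real.exp_pos (-(ε / 2))) (by rw [Real.exp_lt_one_iff]; linarith)
  have h1 : Tendsto (fun n : ℕ => l1 / l2 * c * (Real.exp (ε / 2)) ^ n) atTop atTop :=
    (tendsto_pow_atTop_atTop_of_one_lt (Real.one_lt_exp_iff.2 (by linarith))).const_mul_atTop
      (by positivity)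
  refine tendsto_atTop_mono (fun n => ?_) h1
  rw [inDegreeMass_critical hl2]
  calc l1 / l2 * c * (Real.exp (ε / 2)) ^ n
      = Real.exp (ε * n) * (l1 / l2 * (c * Real.exp (-(ε / 2)) ^ n)) := by
        rw [← Real.exp_nat_mul, ← Real.exp_nat_mul,
          show (n : ℝ) * (ε / 2) = ε * n + n * (-(ε / 2)) by ring, Real.exp_add]
        ring
    _ ≤ Real.exp (ε * (n + 1 : ℕ)) *
        (l1 / l2 * ∫ w in (0 : ℝ)..1, w ^ n * profile 1 (l1 / l2) w) := by
        have := h n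
        have h2 : Real.exp (ε * n) ≤ Real.exp (ε * (n + 1 : ℕ)) := by
          rw [Real.exp_le_exp]; push_cast; nlinarith
        gcongr

theorem tendsto_mul_inDegreeMass (hl1 : 0 < l1) (hl2 : 0 < l2) (hm2 : 0 ≤ m2) :
    Tendsto (fun j : ℕ => (j : ℝ) * inDegreeMass l1 l2 m2 j) atTop (𝓝 0) := by
  rcases lt_trichotomy m2 l2 with h | h | h
  · rw [← tendsto_add_atTop_iff_nat 1]
    have hq : m2 / l2 < 1 := (div_lt_one hl2).2 h
    have := (tendsto_mul_zero_of_tendsto_rpow (div_pos (div_pos hl1 hl2) (by linarith))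
      (tendsto_rpow_mul_integral_profile (q := m2 / l2) (θ := l1 / l2) (by positivity)
      hq (by positivity))).const_mul (l1 / l2)
    rw [mul_zero] at this
    refine this.congr fun n => ?_
    rw [inDegreeMass, if_pos h.le, Nat.add_sub_cancel]; push_cast; ring
  · subst h
    simpa using tendsto_pow_mul_inDegreeMass_critical hl1 hl2 1
  · rw [← tendsto_add_atTop_iff_nat 1]
    have hm : 0 < m2 := hl2.trans h
    have hq : l2 / m2 < 1 := (div_lt_one hm).2 h
    have := (tendsto_mul_zero_of_tendsto_rpow (div_pos (div_pos hl1 hm) (by linarith))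
      (tendsto_rpow_mul_integral_profile (q := l2 / m2) (θ := l1 / m2) (by positivity)
      hq (by positivity))).const_mul (l1 / l2)
    rw [mul_zero] at this
    refine squeeze_zero (fun n => mul_nonneg (by positivity)
      (inDegreeMass_nonneg hl1 hl2 hm2 _)) (fun n => ?_) this
    rw [inDegreeMass, if_neg (not_le.2 h), Nat.add_sub_cancel]
    have h1 : (l2 / m2) ^ (n + 1) ≤ 1 := pow_le_one₀ (by positivity) hq.le
    have h2 := integral_profile_nonneg (θ := l1 / m2) hq.le n
    push_cast
    calc ((n : ℝ) + 1) * (l1 / l2 * (l2 / m2) ^ (n + 1) *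
          ∫ w in (0 : ℝ)..1, w ^ n * profile (l2 / m2) (l1 / m2) w)
        ≤ ((n : ℝ) + 1) * (l1 / l2 * 1 *
          ∫ w in (0 : ℝ)..1, w ^ n * profile (l2 / m2) (l1 / m2) w) := by gcongr
      _ = _ := by ring

theorem inDegreeTail_zero : inDegreeTail l1 l2 m2 0 = 1 := rfl

theorem inDegreeTail_succ (j : ℕ) : inDegreeTail l1 l2 m2 (j + 1) = (if j = 0 then 1 else 0) +
    (l2 * j * inDegreeMass l1 l2 m2 j - m2 * (j + 1) * inDegreeMass l1 l2 m2 (j + 1)) / l1 := rfl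

theorem inDegreeTail_sub (hl1 : 0 < l1) (hl2 : 0 < l2) (hm2 : 0 ≤ m2) (j : ℕ) :
    inDegreeTail l1 l2 m2 (j + 1) - inDegreeTail l1 l2 m2 (j + 2) =
      inDegreeMass l1 l2 m2 (j + 1) := by
  have h := inDegreeMass_recurrence hl1 hl2 hm2 j
  rw [inDegreeTail_succ, inDegreeTail_succ, if_neg (Nat.succ_ne_zero j)]
  push_cast
  split_ifs at h ⊢ <;> field_simp <;> linarith

/-- The Kolmogorov forward equation of the limit, summed over the in-degrees above a level. -/
theorem inDegreeTail_dual (hl1 : 0 < l1) (hl2 : 0 < l2) (hm2 : 0 ≤ m2) (j : ℕ) :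
    l2 * j * inDegreeTail l1 l2 m2 j + m2 * (j + 1) * inDegreeTail l1 l2 m2 (j + 2) -
      (l2 * j + m2 * (j + 1) + l1) * inDegreeTail l1 l2 m2 (j + 1) =
      -(l1 * if j = 0 then 1 else 0) := by
  have h1 := inDegreeTail_sub hl1 hl2 hm2 j
  have h2 : inDegreeTail l1 l2 m2 (j + 2) =
    inDegreeTail l1 l2 m2 (j + 1) - inDegreeMass l1 l2 m2 (j + 1) := by linarith
  have h3 : l2 * j * inDegreeTail l1 l2 m2 j =
      l2 * j * (inDegreeTail l1 l2 m2 (j + 1) + inDegreeMass l1 l2 m2 j) := by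
    rcases j with _ | j
    · simp
    · rw [← inDegreeTail_sub hl1 hl2 hm2 j]; ring
  rw [h2, h3, inDegreeTail_succ]
  field_simp
  ring

theorem tendsto_inDegreeTail (hl1 : 0 < l1) (hl2 : 0 < l2) (hm2 : 0 ≤ m2) :
    Tendsto (inDegreeTail l1 l2 m2) atTop (𝓝 0) := by
  rw [← tendsto_add_atTop_iff_nat 1]
  have h := tendsto_mul_inDegreeMass hl1 hl2 hm2
  have h' := (tendsto_add_atTop_iff_nat 1).2 h
  have := ((h.const_mul l2).sub (h'.const_mul m2)).div_const l1
  simp only [mul_zero, sub_zero, zero_div] at this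
  refine this.congr' ?_
  filter_upwards [eventually_gt_atTop 0] with j hj
  rw [inDegreeTail_succ, if_neg hj.ne']
  push_cast
  ring

theorem antitone_inDegreeTail (hl1 : 0 < l1) (hl2 : 0 < l2) (hm2 : 0 ≤ m2) :
    Antitone (inDegreeTail l1 l2 m2) := by
  refine antitone_nat_of_succ_le fun j => ?_
  rcases j with _ | j
  · rw [inDegreeTail_succ, inDegreeTail_zero]
    have : 0 ≤ m2 * inDegreeMass l1 l2 m2 1 / l1 :=
      div_nonneg (mul_nonneg hm2 (inDegreeMass_nonneg hl1 hl2 hm2 1)) hl1.le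
    simp [neg_div]
    exact this
  · have := inDegreeTail_sub hl1 hl2 hm2 j
    have := inDegreeMass_nonneg hl1 hl2 hm2 (j + 1)
    linarith

theorem inDegreeTail_nonneg (hl1 : 0 < l1) (hl2 : 0 < l2) (hm2 : 0 ≤ m2) (j : ℕ) :
    0 ≤ inDegreeTail l1 l2 m2 j :=
  (antitone_inDegreeTail hl1 hl2 hm2).le_of_tendsto (tendsto_inDegreeTail hl1 hl2 hm2) j

theorem inDegreeTail_le_one (hl1 : 0 < l1) (hl2 : 0 < l2) (hm2 : 0 ≤ m2) (j : ℕ) :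
    inDegreeTail l1 l2 m2 j ≤ 1 :=
  antitone_inDegreeTail hl1 hl2 hm2 (Nat.zero_le j)

theorem hasSum_inDegreeTail_sub (hl1 : 0 < l1) (hl2 : 0 < l2) (hm2 : 0 ≤ m2) :
    HasSum (fun j => inDegreeTail l1 l2 m2 j - inDegreeTail l1 l2 m2 (j + 1)) 1 := by
  rw [hasSum_iff_tendsto_nat_of_nonneg fun j =>
    sub_nonneg.2 (antitone_inDegreeTail hl1 hl2 hm2 (Nat.le_succ j))]
  simp only [Finset.sum_range_sub']
  simpa [inDegreeTail_zero] using (tendsto_inDegreeTail hl1 hl2 hm2).const_sub 1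

/-- The distribution `(p_j)` of the limiting in-degree. -/
noncomputable def inDegreePMF (hl1 : 0 < l1) (hl2 : 0 < l2) (hm2 : 0 ≤ m2) : PMF ℕ :=
  ⟨fun j => ENNReal.ofReal (inDegreeTail l1 l2 m2 j - inDegreeTail l1 l2 m2 (j + 1)), by
    have h := hasSum_inDegreeTail_sub hl1 hl2 hm2
    have h1 := ENNReal.ofReal_tsum_of_nonneg (fun j => sub_nonneg.2
      (antitone_inDegreeTail hl1 hl2 hm2 (Nat.le_succ j))) h.summable
    rw [h.tsum_eq, ENNReal.ofReal_one] at h1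
    exact h1 ▸ ENNReal.summable.hasSum⟩

theorem inDegreePMF_apply (hl1 : 0 < l1) (hl2 : 0 < l2) (hm2 : 0 ≤ m2) (j : ℕ) :
    inDegreePMF hl1 hl2 hm2 j =
      ENNReal.ofReal (inDegreeTail l1 l2 m2 j - inDegreeTail l1 l2 m2 (j + 1)) := rfl

theorem toReal_inDegreePMF_succ (hl1 : 0 < l1) (hl2 : 0 < l2) (hm2 : 0 ≤ m2) (j : ℕ) :
    (inDegreePMF hl1 hl2 hm2 (j + 1)).toReal = inDegreeMass l1 l2 m2 (j + 1) := by
  rw [inDegreePMF_apply, inDegreeTail_sub hl1 hl2 hm2,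
    ENNReal.toReal_ofReal (inDegreeMass_nonneg hl1 hl2 hm2 _)]

theorem eventually_toReal_inDegreePMF (hl1 : 0 < l1) (hl2 : 0 < l2) (hm2 : 0 ≤ m2) :
    ∀ᶠ j in atTop, inDegreeMass l1 l2 m2 j = (inDegreePMF hl1 hl2 hm2 j).toReal := by
  filter_upwards [eventually_gt_atTop 0] with j hj
  obtain ⟨k, rfl⟩ := Nat.exists_eq_succ_of_ne_zero hj.ne'
  exact (toReal_inDegreePMF_succ hl1 hl2 hm2 k).symm

/-! ### The mean in-degree -/

/-- The truncated first moments, from summing the dual equation over the levels. -/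
theorem sum_mul_inDegreeMass (hl1 : 0 < l1) (hl2 : 0 < l2) (hm2 : 0 ≤ m2) (n : ℕ) :
    (l1 - (l2 - m2)) * ∑ j ∈ Finset.range (n + 2), (j : ℝ) * inDegreeMass l1 l2 m2 j =
      l1 - l1 * ((n + 1) * inDegreeTail l1 l2 m2 (n + 2)) -
        l2 * ((n + 1) * inDegreeMass l1 l2 m2 (n + 1)) := by
  induction n with
  | zero =>
    have h1 := inDegreeTail_sub hl1 hl2 hm2 0
    have h2 : l1 * inDegreeTail l1 l2 m2 1 = l1 - m2 * inDegreeMass l1 l2 m2 1 := by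
      rw [inDegreeTail_succ]; simp; field_simp; ring
    simp [Finset.sum_range_succ] at h1 ⊢
    rw [show inDegreeTail l1 l2 m2 2 = inDegreeTail l1 l2 m2 1 - inDegreeMass l1 l2 m2 1 by
      linarith, mul_sub, h2]
    ring
  | succ n ih =>
    have h1 := inDegreeTail_sub hl1 hl2 hm2 (n + 1)
    have h2 : l1 * inDegreeTail l1 l2 m2 (n + 2) = l2 * (n + 1) * inDegreeMass l1 l2 m2 (n + 1) -
        m2 * (n + 2) * inDegreeMass l1 l2 m2 (n + 2) := by
      rw [inDegreeTail_succ, if_neg (Nat.succ_ne_zero n)]; push_cast; field_simp; ring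
    rw [Finset.sum_range_succ, mul_add, ih]
    have h3 : inDegreeTail l1 l2 m2 (n + 1 + 2) =
      inDegreeTail l1 l2 m2 (n + 2) - inDegreeMass l1 l2 m2 (n + 2) := by
      rw [← h1]; ring
    rw [h3]
    push_cast
    linear_combination h2

theorem tendsto_mul_inDegreeTail_of_summable (hl1 : 0 < l1) (hl2 : 0 < l2) (hm2 : 0 ≤ m2)
    (hs : Summable fun j : ℕ => (j : ℝ) * inDegreeMass l1 l2 m2 j) :
    Tendsto (fun n : ℕ => ((n : ℝ) + 1) * inDegreeTail l1 l2 m2 (n + 2)) atTop (𝓝 0) := by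
  set S : ℕ → ℝ := fun n => ∑ j ∈ Finset.range n, (j : ℝ) * inDegreeMass l1 l2 m2 j with hS
  have hlim : Tendsto S atTop (𝓝 (∑' j : ℕ, (j : ℝ) * inDegreeMass l1 l2 m2 j)) :=
    hs.hasSum.tendsto_sum_nat
  have hle : ∀ n k : ℕ, n ≤ k → ((n : ℝ) + 1) * inDegreeTail l1 l2 m2 (n + 2) + S (n + 2) ≤
      ((n : ℝ) + 1) * inDegreeTail l1 l2 m2 (k + 2) + S (k + 2) := by
    intro n k hk
    induction k, hk using Nat.le_induction with
    | base => exact le_rfl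
    | succ k hk ih =>
      refine ih.trans ?_
      have h1 := inDegreeTail_sub hl1 hl2 hm2 (k + 1)
      have h2 : S (k + 1 + 2) = S (k + 2) + ((k + 2 : ℕ) : ℝ) * inDegreeMass l1 l2 m2 (k + 2) :=
        Finset.sum_range_succ _ _
      have h3 : inDegreeTail l1 l2 m2 (k + 2) =
        inDegreeTail l1 l2 m2 (k + 1 + 2) + inDegreeMass l1 l2 m2 (k + 2) := by rw [← h1]; ring
      have h4 : ((n : ℝ) + 1) * inDegreeMass l1 l2 m2 (k + 2) ≤
          ((k + 2 : ℕ) : ℝ) * inDegreeMass l1 l2 m2 (k + 2) := by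
        have := inDegreeMass_nonneg hl1 hl2 hm2 (k + 2)
        have h5 : (n : ℝ) ≤ k := by exact_mod_cast hk
        push_cast
        gcongr
        linarith
      rw [h2, h3]; linarith
  have hle' : ∀ n : ℕ, ((n : ℝ) + 1) * inDegreeTail l1 l2 m2 (n + 2) ≤
      (∑' j : ℕ, (j : ℝ) * inDegreeMass l1 l2 m2 j) - S (n + 2) := by
    intro n
    have h1 : Tendsto (fun k => ((n : ℝ) + 1) * inDegreeTail l1 l2 m2 (k + 2) + S (k + 2)) atTop
        (𝓝 (((n : ℝ) + 1) * 0 + ∑' j : ℕ, (j : ℝ) * inDegreeMass l1 l2 m2 j)) :=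
      (((tendsto_add_atTop_iff_nat 2).2 (tendsto_inDegreeTail hl1 hl2 hm2)).const_mul _).add
        ((tendsto_add_atTop_iff_nat 2).2 hlim)
    have := ge_of_tendsto h1 ((eventually_ge_atTop n).mono fun k hk => hle n k hk)
    linarith
  refine squeeze_zero (fun n => mul_nonneg (by positivity) (inDegreeTail_nonneg hl1 hl2 hm2 _))
    hle' ?_
  simpa using ((tendsto_add_atTop_iff_nat 2).2 hlim).const_sub
    (∑' j : ℕ, (j : ℝ) * inDegreeMass l1 l2 m2 j)

theorem mul_tsum_inDegreeMass (hl1 : 0 < l1) (hl2 : 0 < l2) (hm2 : 0 ≤ m2)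
    (hs : Summable fun j : ℕ => (j : ℝ) * inDegreeMass l1 l2 m2 j) :
    (l1 - (l2 - m2)) * ∑' j : ℕ, (j : ℝ) * inDegreeMass l1 l2 m2 j = l1 := by
  have h1 := ((tendsto_add_atTop_iff_nat 2).2 hs.hasSum.tendsto_sum_nat).const_mul (l1 - (l2 - m2))
  simp only [sum_mul_inDegreeMass hl1 hl2 hm2] at h1
  have h2 := ((tendsto_mul_inDegreeTail_of_summable hl1 hl2 hm2 hs).const_mul l1).const_sub l1
  have h3 := ((tendsto_add_atTop_iff_nat 1).2 (tendsto_mul_inDegreeMass hl1 hl2 hm2)).const_mul l2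
  have h4 := h2.sub h3
  simp only [mul_zero, sub_zero] at h4
  push_cast at h4
  exact tendsto_nhds_unique h1 h4

theorem summable_mul_inDegreeMass (hl1 : 0 < l1) (hl2 : 0 < l2) (hm2 : 0 ≤ m2)
    (h : 0 < l1 - (l2 - m2)) : Summable fun j : ℕ => (j : ℝ) * inDegreeMass l1 l2 m2 j := by
  have hnn : ∀ j : ℕ, 0 ≤ (j : ℝ) * inDegreeMass l1 l2 m2 j := fun j =>
    mul_nonneg (by positivity) (inDegreeMass_nonneg hl1 hl2 hm2 j)
  refine summable_of_sum_range_le (c := l1 / (l1 - (l2 - m2))) hnn fun n => ?_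
  refine (Finset.sum_le_sum_of_subset_of_nonneg (Finset.range_mono (by omega : n ≤ n + 2))
    fun j _ _ => hnn j).trans ?_
  rw [le_div_iff₀' h, sum_mul_inDegreeMass hl1 hl2 hm2]
  have h1 : 0 ≤ l1 * (((n : ℝ) + 1) * inDegreeTail l1 l2 m2 (n + 2)) :=
    mul_nonneg hl1.le (mul_nonneg (by positivity) (inDegreeTail_nonneg hl1 hl2 hm2 _))
  have h2 : 0 ≤ l2 * (((n : ℝ) + 1) * inDegreeMass l1 l2 m2 (n + 1)) :=
    mul_nonneg hl2.le (mul_nonneg (by positivity) (inDegreeMass_nonneg hl1 hl2 hm2 _))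
  linarith

theorem lintegral_inDegreePMF (hl1 : 0 < l1) (hl2 : 0 < l2) (hm2 : 0 ≤ m2) :
    ∫⁻ j, (j : ℝ≥0∞) ∂(inDegreePMF hl1 hl2 hm2).toMeasure =
      ∑' j : ℕ, ENNReal.ofReal ((j : ℝ) * inDegreeMass l1 l2 m2 j) := by
  rw [lintegral_countable']
  refine tsum_congr fun j => ?_
  rw [PMF.toMeasure_apply_singleton _ _ (measurableSet_singleton j)]
  rcases j with _ | j
  · simp
  · rw [ENNReal.ofReal_mul (by positivity), ← toReal_inDegreePMF_succ hl1 hl2 hm2,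
      ENNReal.ofReal_toReal (PMF.apply_ne_top _ _), ENNReal.ofReal_natCast]

theorem lintegral_inDegreePMF_of_pos (hl1 : 0 < l1) (hl2 : 0 < l2) (hm2 : 0 ≤ m2)
    (h : 0 < l1 - (l2 - m2)) : ∫⁻ j, (j : ℝ≥0∞) ∂(inDegreePMF hl1 hl2 hm2).toMeasure =
      ENNReal.ofReal (l1 / (l1 - (l2 - m2))) := by
  have hs := summable_mul_inDegreeMass hl1 hl2 hm2 h
  rw [lintegral_inDegreePMF, ← ENNReal.ofReal_tsum_of_nonneg (fun j =>
    mul_nonneg (by positivity) (inDegreeMass_nonneg hl1 hl2 hm2 j)) hs]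
  congr 1
  rw [eq_div_iff h.ne', mul_comm]
  exact mul_tsum_inDegreeMass hl1 hl2 hm2 hs

theorem lintegral_inDegreePMF_of_nonpos (hl1 : 0 < l1) (hl2 : 0 < l2) (hm2 : 0 ≤ m2)
    (h : l1 - (l2 - m2) ≤ 0) : ∫⁻ j, (j : ℝ≥0∞) ∂(inDegreePMF hl1 hl2 hm2).toMeasure = ∞ := by
  have hnn : ∀ j : ℕ, 0 ≤ (j : ℝ) * inDegreeMass l1 l2 m2 j := fun j =>
    mul_nonneg (by positivity) (inDegreeMass_nonneg hl1 hl2 hm2 j)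
  rw [lintegral_inDegreePMF]
  by_contra hne
  have hs : Summable fun j : ℕ => (j : ℝ) * inDegreeMass l1 l2 m2 j := by
    exact (ENNReal.summable_toReal hne).congr fun j => ENNReal.toReal_ofReal (hnn j)
  have h1 := mul_tsum_inDegreeMass hl1 hl2 hm2 hs
  have h2 : 0 ≤ ∑' j : ℕ, (j : ℝ) * inDegreeMass l1 l2 m2 j := tsum_nonneg hnn
  linarith [mul_nonpos_of_nonpos_of_nonneg h h2]

end Stationary

/-! ### The one-step operator of the chain -/

namespace InDegreeState

instance : Countable InDegreeState :=
  Function.Injective.countable (f := toList) fun _ _ h => InDegreeState.ext h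

instance : DiscreteMeasurableSpace InDegreeState := ⟨fun _ => trivial⟩

/-- The state with the entry at position `i` replaced by `v`. -/
def setEntry (x : InDegreeState) (i v : ℕ) : InDegreeState :=
  ⟨x.toList.set i v, by simpa [← List.length_pos_iff] using x.ne_nil⟩

/-- The state with an entry `1` appended. -/
def addVertex (x : InDegreeState) : InDegreeState := ⟨x.toList ++ [1], by simp⟩

/-- The sum of `φ` over the entries of a state. -/
def entrySum (φ : ℕ → ℝ) (x : InDegreeState) : ℝ := ∑ i ∈ Finset.range x.len, φ (x.entry i)

/-- The mean of `φ` over the entries of a state. -/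
noncomputable def entryMean (φ : ℕ → ℝ) (x : InDegreeState) : ℝ := entrySum φ x / x.len

theorem len_pos (x : InDegreeState) : 0 < x.len := List.length_pos_iff.2 x.ne_nil

@[simp] theorem len_setEntry (x : InDegreeState) (i v : ℕ) : (x.setEntry i v).len = x.len := by
  simp [len, setEntry]

@[simp] theorem len_addVertex (x : InDegreeState) : x.addVertex.len = x.len + 1 := by
  simp [len, addVertex]

theorem entrySum_setEntry (φ : ℕ → ℝ) (x : InDegreeState) {i : ℕ} (hi : i < x.len) (v : ℕ) :
    entrySum φ (x.setEntry i v) = entrySum φ x + (φ v - φ (x.entry i)) := by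
  unfold entrySum
  rw [len_setEntry]
  have h : ∀ k ∈ Finset.range x.len, φ ((x.setEntry i v).entry k) =
      φ (x.entry k) + if k = i then φ v - φ (x.entry i) else 0 := by
    intro k hk
    have hk' : k < x.toList.length := Finset.mem_range.1 hk
    have h1 : (x.setEntry i v).entry k = if k = i then v else x.entry k := by
      simp only [entry, setEntry, List.getD_eq_getElem?_getD, List.getElem?_set]
      by_cases hki : k = i
      · subst hki; simp [hk']
      · simp [hki, Ne.symm hki]
    rw [h1]
    split_ifs with hki
    · subst hki; ring
    · ring
  rw [Finset.sum_congr rfl h, Finset.sum_add_distrib, Finset.sum_ite_eq',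
    if_pos (Finset.mem_range.2 hi)]

theorem entrySum_addVertex (φ : ℕ → ℝ) (x : InDegreeState) :
    entrySum φ x.addVertex = entrySum φ x + φ 1 := by
  unfold entrySum
  rw [len_addVertex, Finset.sum_range_succ]
  congr 1
  · refine Finset.sum_congr rfl fun k hk => ?_
    have hk' : k < x.toList.length := Finset.mem_range.1 hk
    simp [entry, addVertex, List.getElem?_append_left hk', List.getD_eq_getElem?_getD]
  · simp [entry, addVertex, len, List.getD_eq_getElem?_getD]

theorem total_eq_entrySum (x : InDegreeState) : (x.total : ℝ) = entrySum (fun k => (k : ℝ)) x := by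
  unfold entrySum total len entry
  induction x.toList with
  | nil => simp
  | cons a l ih =>
    rw [List.sum_cons, List.length_cons, Finset.sum_range_succ']
    rw [Nat.cast_add, ih]
    simp [add_comm]

/-- The total jump rate `Z` of the continuous-time version of the chain. -/
noncomputable def rate (l1 l2 m2 : ℝ) (x : InDegreeState) : ℝ :=
  (l2 + m2) * (x.total : ℝ) + (x.len : ℝ) * l1

end InDegreeState

open InDegreeState

/-- The expectation of `F` after one step of the chain from `x`. -/
noncomputable def stepMean (l1 l2 m2 : ℝ) (F : InDegreeState → ℝ) (x : InDegreeState) : ℝ :=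
  ((∑ i ∈ Finset.range x.len, (x.entry i : ℝ) * l2 * F (x.setEntry i (x.entry i + 1))) +
    (∑ i ∈ Finset.range x.len, (x.entry i : ℝ) * m2 * F (x.setEntry i (x.entry i - 1))) +
    (x.len : ℝ) * l1 * F x.addVertex) / rate l1 l2 m2 x

section Step

variable {l1 l2 m2 : ℝ}

theorem InDegreeState.rate_pos (hl1 : 0 < l1) (hl2 : 0 < l2) (hm2 : 0 ≤ m2) (x : InDegreeState) :
    0 < rate l1 l2 m2 x := by
  have h : (0 : ℝ) < x.len := by exact_mod_cast x.len_pos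
  unfold rate
  positivity

theorem hasSum_attachDetachProb_mul (F : InDegreeState → ℝ) (x : InDegreeState) :
    HasSum (fun y => attachDetachProb l1 l2 m2 x y * F y) (stepMean l1 l2 m2 F x) := by
  classical
  have hs : ∀ (z : InDegreeState) (c : ℝ),
      HasSum (fun y : InDegreeState => (if y.toList = z.toList then c else 0) * F y) (c * F z) := by
    intro z c
    have h := hasSum_single (f := fun y : InDegreeState =>
      (if y.toList = z.toList then c else 0) * F y) z fun y hy => by
        rw [if_neg fun h => hy (InDegreeState.ext h), zero_mul]
    rwa [if_pos rfl] at h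
  have h := (((hasSum_sum (s := Finset.range x.len) fun i _ =>
    hs (x.setEntry i (x.entry i + 1)) ((x.entry i : ℝ) * l2)).add
    (hasSum_sum (s := Finset.range x.len) fun i _ =>
      hs (x.setEntry i (x.entry i - 1)) ((x.entry i : ℝ) * m2))).add
    (hs x.addVertex ((x.len : ℝ) * l1))).div_const (rate l1 l2 m2 x)
  convert! h using 2 with y
  simp only [attachDetachProb, rate, setEntry, addVertex, div_mul_eq_mul_div, add_mul,
    Finset.sum_mul]
  congr!

theorem stepMean_sub (hl1 : 0 < l1) (hl2 : 0 < l2) (hm2 : 0 ≤ m2) (F : InDegreeState → ℝ)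
    (x : InDegreeState) (c : ℝ) :
    stepMean l1 l2 m2 F x - c = stepMean l1 l2 m2 (fun y => F y - c) x := by
  have hZ := rate_pos hl1 hl2 hm2 x
  unfold stepMean
  rw [eq_div_iff hZ.ne', sub_mul, div_mul_cancel₀ _ hZ.ne']
  simp only [mul_sub, Finset.sum_sub_distrib, ← Finset.sum_mul]
  have : ∑ i ∈ Finset.range x.len, (x.entry i : ℝ) = x.total := (total_eq_entrySum x).symm
  rw [this, rate]
  ring

theorem stepMean_mono (hl1 : 0 < l1) (hl2 : 0 < l2) (hm2 : 0 ≤ m2) {F G : InDegreeState → ℝ}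
    (h : ∀ y, F y ≤ G y) (x : InDegreeState) : stepMean l1 l2 m2 F x ≤ stepMean l1 l2 m2 G x := by
  have hZ := rate_pos hl1 hl2 hm2 x
  unfold stepMean
  gcongr <;> exact h _

theorem stepMean_const (hl1 : 0 < l1) (hl2 : 0 < l2) (hm2 : 0 ≤ m2) (c : ℝ) (x : InDegreeState) :
    stepMean l1 l2 m2 (fun _ => c) x = c := by
  have := stepMean_sub hl1 hl2 hm2 (fun _ => c) x c
  simp only [sub_self] at this
  have h0 : stepMean l1 l2 m2 (fun _ => (0 : ℝ)) x = 0 := by simp [stepMean]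
  linarith

theorem abs_stepMean_le (hl1 : 0 < l1) (hl2 : 0 < l2) (hm2 : 0 ≤ m2) {F : InDegreeState → ℝ}
    {B : ℝ} (h : ∀ y, |F y| ≤ B) (x : InDegreeState) : |stepMean l1 l2 m2 F x| ≤ B := by
  rw [abs_le]
  have h1 := stepMean_mono hl1 hl2 hm2 (F := fun _ => -B) (fun y => (abs_le.1 (h y)).1) x
  have h2 := stepMean_mono hl1 hl2 hm2 (G := fun _ => B) (fun y => (abs_le.1 (h y)).2) x
  rw [stepMean_const hl1 hl2 hm2] at h1 h2
  exact ⟨h1, h2⟩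

/-- The variance of one step is at most the mean square displacement. -/
theorem stepMean_sq_sub_sq_le (hl1 : 0 < l1) (hl2 : 0 < l2) (hm2 : 0 ≤ m2) (F : InDegreeState → ℝ)
    (x : InDegreeState) : stepMean l1 l2 m2 (fun y => F y ^ 2) x - stepMean l1 l2 m2 F x ^ 2 ≤
      stepMean l1 l2 m2 (fun y => (F y - F x) ^ 2) x := by
  have h : stepMean l1 l2 m2 (fun y => (F y - F x) ^ 2) x =
      stepMean l1 l2 m2 (fun y => F y ^ 2) x - 2 * F x * stepMean l1 l2 m2 F x + F x ^ 2 := by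
    have h1 : stepMean l1 l2 m2 (fun y => (F y - F x) ^ 2) x - F x ^ 2 =
        stepMean l1 l2 m2 (fun y => F y ^ 2) x - 2 * F x * stepMean l1 l2 m2 F x := by
      rw [stepMean_sub hl1 hl2 hm2]
      unfold stepMean
      rw [← mul_div_assoc, ← sub_div]
      congr 1
      simp only [mul_add, Finset.mul_sum]
      rw [show ∀ a b c d e f : ℝ, a + b + c - (d + e + f) = (a - d) + (b - e) + (c - f) by
        intros; ring, ← Finset.sum_sub_distrib, ← Finset.sum_sub_distrib]
      congr 1
      · congr 1 <;> exact Finset.sum_congr rfl fun i _ => by ring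
      · ring
    linarith
  rw [h]
  nlinarith [sq_nonneg (stepMean l1 l2 m2 F x - F x)]

theorem attachDetachProb_ne_zero {x y : InDegreeState} (h : attachDetachProb l1 l2 m2 x y ≠ 0) :
    x.len ≤ y.len ∧ y.len ≤ x.len + 1 ∧ y.total ≤ x.total + 1 := by
  have hset : ∀ i ∈ Finset.range x.len, ∀ v ≤ x.entry i + 1, y.toList = x.toList.set i v →
      x.len ≤ y.len ∧ y.len ≤ x.len + 1 ∧ y.total ≤ x.total + 1 := by
    intro i hi v hv hy
    have hy' : y = x.setEntry i v := InDegreeState.ext hy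
    subst hy'
    refine ⟨by simp, by simp, ?_⟩
    have h1 := total_eq_entrySum (x.setEntry i v)
    rw [entrySum_setEntry _ _ (Finset.mem_range.1 hi), ← total_eq_entrySum] at h1
    have h2 : (v : ℝ) ≤ x.entry i + 1 := by exact_mod_cast hv
    have h3 : ((x.setEntry i v).total : ℝ) ≤ x.total + 1 := by linarith
    exact_mod_cast h3
  by_contra hcon
  refine h ?_
  unfold attachDetachProb
  rw [Finset.sum_eq_zero, Finset.sum_eq_zero, if_neg]
  · simp
  · intro hy
    have hy' : y = x.addVertex := InDegreeState.ext hy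
    subst hy'
    exact hcon ⟨by simp, by simp, by simp [total, addVertex]⟩
  · intro i hi
    rw [if_neg fun hy => hcon (hset i hi _ (by omega) hy)]
  · intro i hi
    rw [if_neg fun hy => hcon (hset i hi _ le_rfl hy)]

theorem abs_entryMean_le {φ : ℕ → ℝ} {B : ℝ} (h : ∀ k, |φ k| ≤ B) (x : InDegreeState) :
    |entryMean φ x| ≤ B := by
  have hL : (0 : ℝ) < x.len := by exact_mod_cast x.len_pos
  rw [entryMean, abs_div, abs_of_pos hL, div_le_iff₀ hL]
  refine (Finset.abs_sum_le_sum_abs _ _).trans ?_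
  refine (Finset.sum_le_sum fun i _ => h (x.entry i)).trans ?_
  simp [mul_comm]

/-- The drift of an entry mean: individual births and deaths act through the birth-death
generator, and new vertices pull the mean towards `φ 1`. -/
theorem stepMean_entryMean_sub (hl1 : 0 < l1) (hl2 : 0 < l2) (hm2 : 0 ≤ m2) (φ : ℕ → ℝ)
    (x : InDegreeState) : stepMean l1 l2 m2 (entryMean φ) x - entryMean φ x =
      (rate l1 l2 m2 x)⁻¹ * (entryMean (fun k => l2 * k * (φ (k + 1) - φ k) +
        m2 * k * (φ (k - 1) - φ k)) x + l1 * (φ 1 - entryMean φ x)) -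
      l1 * (φ 1 - entryMean φ x) * ((rate l1 l2 m2 x)⁻¹ * ((x.len : ℝ) + 1)⁻¹) := by
  have hZ := rate_pos hl1 hl2 hm2 x
  have hL : (0 : ℝ) < x.len := by exact_mod_cast x.len_pos
  rw [stepMean_sub hl1 hl2 hm2, stepMean]
  have h1 : ∀ (c : ℝ) (v : ℕ → ℕ), ∑ i ∈ Finset.range x.len, (x.entry i : ℝ) * c *
      (entryMean φ (x.setEntry i (v (x.entry i))) - entryMean φ x) =
      entryMean (fun k => c * k * (φ (v k) - φ k)) x := by
    intro c v
    conv_rhs => rw [entryMean, entrySum, Finset.sum_div]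
    refine Finset.sum_congr rfl fun i hi => ?_
    rw [entryMean, entrySum_setEntry _ _ (Finset.mem_range.1 hi), len_setEntry, entryMean]
    ring
  have h2 : entryMean φ x.addVertex - entryMean φ x = (φ 1 - entryMean φ x) / (x.len + 1) := by
    rw [entryMean, entrySum_addVertex, len_addVertex, entryMean]
    push_cast
    field_simp
    ring
  have h3 : entryMean (fun k => l2 * k * (φ (k + 1) - φ k) + m2 * k * (φ (k - 1) - φ k)) x =
      entryMean (fun k => l2 * k * (φ (k + 1) - φ k)) x +
        entryMean (fun k => m2 * k * (φ (k - 1) - φ k)) x := by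
    simp only [entryMean, entrySum, Finset.sum_add_distrib, add_div]
  rw [h1 l2 (· + 1), h1 m2 (· - 1), h2, h3]
  field_simp
  ring

/-- The conditional variance of an entry mean is of order `1 / (Z ℓ)`. -/
theorem stepMean_entryMean_sq_le (hl1 : 0 < l1) (hl2 : 0 < l2) (hm2 : 0 ≤ m2) {φ : ℕ → ℝ} {C : ℝ}
    (hC : 0 ≤ C) (h0 : ∀ k, 0 ≤ φ k) (h1 : ∀ k, φ k ≤ 1)
    (hφ : ∀ k : ℕ, l2 * k * (φ (k + 1) - φ k) ^ 2 + m2 * k * (φ (k - 1) - φ k) ^ 2 ≤ C)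
    (x : InDegreeState) :
    stepMean l1 l2 m2 (fun y => (entryMean φ y - entryMean φ x) ^ 2) x ≤
      (2 * C + l1) * ((rate l1 l2 m2 x)⁻¹ * ((x.len : ℝ) + 1)⁻¹) := by
  have hZ := rate_pos hl1 hl2 hm2 x
  have hL : (1 : ℝ) ≤ x.len := by exact_mod_cast x.len_pos
  have hL0 : (0 : ℝ) < x.len := by linarith
  have e1 : ∀ (c : ℝ) (v : ℕ → ℕ), ∑ i ∈ Finset.range x.len, (x.entry i : ℝ) * c *
      (entryMean φ (x.setEntry i (v (x.entry i))) - entryMean φ x) ^ 2 =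
      entrySum (fun k => c * k * (φ (v k) - φ k) ^ 2) x / (x.len : ℝ) ^ 2 := by
    intro c v
    rw [entrySum, Finset.sum_div]
    refine Finset.sum_congr rfl fun i hi => ?_
    rw [entryMean, entrySum_setEntry _ _ (Finset.mem_range.1 hi), len_setEntry, entryMean]
    field_simp
    ring
  have e2 : entryMean φ x.addVertex - entryMean φ x = (φ 1 - entryMean φ x) / (x.len + 1) := by
    rw [entryMean, entrySum_addVertex, len_addVertex, entryMean]
    push_cast
    field_simp
    ring
  have e3 : entrySum (fun k => l2 * k * (φ (k + 1) - φ k) ^ 2) x +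
      entrySum (fun k => m2 * k * (φ (k - 1) - φ k) ^ 2) x ≤ C * x.len := by
    simp only [entrySum, ← Finset.sum_add_distrib]
    refine (Finset.sum_le_sum fun i _ => hφ (x.entry i)).trans ?_
    simp [mul_comm]
  have e4 : 0 ≤ entryMean φ x :=
    div_nonneg (Finset.sum_nonneg fun i _ => h0 _) hL0.le
  have e5 : entryMean φ x ≤ 1 :=
    (le_abs_self _).trans (abs_entryMean_le (fun k => abs_le.2 ⟨by linarith [h0 k], h1 k⟩) x)
  have e6 : (φ 1 - entryMean φ x) ^ 2 ≤ 1 := by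
    have := h0 1; have := h1 1
    rw [sq_le_one_iff_abs_le_one, abs_le]; constructor <;> linarith
  have e7 : C * x.len / (x.len : ℝ) ^ 2 ≤ 2 * C / (x.len + 1) := by
    rw [div_le_div_iff₀ (by positivity) (by positivity)]
    nlinarith [mul_nonneg hC hL0.le]
  have e8 : (x.len : ℝ) * l1 * ((φ 1 - entryMean φ x) / (x.len + 1)) ^ 2 ≤ l1 / (x.len + 1) := by
    rw [div_pow, ← mul_div_assoc, div_le_div_iff₀ (by positivity) (by positivity)]
    have : (x.len : ℝ) * l1 * (φ 1 - entryMean φ x) ^ 2 ≤ (x.len + 1) * l1 * 1 := by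
      gcongr; linarith
    nlinarith
  have e9 := div_le_div_of_nonneg_right e3 (by positivity : (0 : ℝ) ≤ (x.len : ℝ) ^ 2)
  rw [add_div] at e9
  rw [stepMean, e1 l2 (· + 1), e1 m2 (· - 1), e2, div_le_iff₀ hZ,
    show (2 * C + l1) * ((rate l1 l2 m2 x)⁻¹ * ((x.len : ℝ) + 1)⁻¹) * rate l1 l2 m2 x =
      2 * C / (x.len + 1) + l1 / (x.len + 1) by field_simp]
  linarith

theorem stepMean_inv_len_sub (hl1 : 0 < l1) (hl2 : 0 < l2) (hm2 : 0 ≤ m2) (x : InDegreeState) :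
    stepMean l1 l2 m2 (fun y => (y.len : ℝ)⁻¹) x - (x.len : ℝ)⁻¹ =
      -(l1 * ((rate l1 l2 m2 x)⁻¹ * ((x.len : ℝ) + 1)⁻¹)) := by
  have hZ := rate_pos hl1 hl2 hm2 x
  have hL : (0 : ℝ) < x.len := by exact_mod_cast x.len_pos
  rw [stepMean_sub hl1 hl2 hm2, stepMean]
  simp only [len_setEntry, sub_self, mul_zero, Finset.sum_const_zero, len_addVertex, zero_add]
  push_cast
  field_simp
  ring

theorem stepMean_inv_len_sq_le (hl1 : 0 < l1) (hl2 : 0 < l2) (hm2 : 0 ≤ m2) (x : InDegreeState) :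
    stepMean l1 l2 m2 (fun y => ((y.len : ℝ)⁻¹ - (x.len : ℝ)⁻¹) ^ 2) x ≤
      l1 * ((rate l1 l2 m2 x)⁻¹ * ((x.len : ℝ) + 1)⁻¹) := by
  have hZ := rate_pos hl1 hl2 hm2 x
  have hL : (1 : ℝ) ≤ x.len := by exact_mod_cast x.len_pos
  have hL0 : (0 : ℝ) < x.len := by linarith
  rw [stepMean]
  simp only [len_setEntry, sub_self, ne_eq, OfNat.ofNat_ne_zero, not_false_eq_true, zero_pow,
    mul_zero, Finset.sum_const_zero, len_addVertex, zero_add]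
  push_cast
  rw [div_le_iff₀ hZ, show ((x.len : ℝ) + 1)⁻¹ - (x.len : ℝ)⁻¹ =
    -((x.len : ℝ) * (x.len + 1))⁻¹ by field_simp; ring, neg_sq,
    show l1 * ((rate l1 l2 m2 x)⁻¹ * ((x.len : ℝ) + 1)⁻¹) * rate l1 l2 m2 x =
      l1 * ((x.len : ℝ) + 1)⁻¹ by field_simp,
    show (x.len : ℝ) * l1 * (((x.len : ℝ) * (x.len + 1))⁻¹) ^ 2 =
      l1 * ((x.len : ℝ) + 1)⁻¹ * ((x.len : ℝ) * (x.len + 1))⁻¹ by field_simp]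
  refine mul_le_of_le_one_right (by positivity) (inv_le_one_of_one_le₀ ?_)
  nlinarith

end Step

/-! ### The martingale part of an additive functional -/

section Chain

variable {Ω : Type*} [MeasurableSpace Ω] {l1 l2 m2 : ℝ} {P : Measure Ω}
  {d : ℕ → Ω → InDegreeState}

/-- The path of the chain up to time `t`. -/
def history (d : ℕ → Ω → InDegreeState) (t : ℕ) (ω : Ω) : Fin (t + 1) → InDegreeState :=
  fun s => d s ω

theorem measurable_history (hd : IsAttachDetachChain l1 l2 m2 P d) (t : ℕ) :
    Measurable (history d t) :=
  measurable_pi_iff.2 fun s => hd.measurable s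

/-- The filtration generated by the chain. -/
def chainFiltration (hd : IsAttachDetachChain l1 l2 m2 P d) :
    Filtration ℕ (inferInstance : MeasurableSpace Ω) where
  seq t := MeasurableSpace.comap (history d t) inferInstance
  mono' s t hst := by
    have h : history d s = (fun h : Fin (t + 1) → InDegreeState => fun r : Fin (s + 1) =>
        h ⟨r, by omega⟩) ∘ history d t := rfl
    change MeasurableSpace.comap (history d s) _ ≤ _
    rw [h, ← MeasurableSpace.comap_comp]
    exact MeasurableSpace.comap_mono (Measurable.comap_le (measurable_of_countable _))
  le' t := (measurable_history hd t).comap_le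

theorem measureReal_history_inter (hd : IsAttachDetachChain l1 l2 m2 P d) (t : ℕ)
    (h : Fin (t + 1) → InDegreeState) (y : InDegreeState) :
    P.real {ω | history d t ω = h ∧ d (t + 1) ω = y} =
      P.real {ω | history d t ω = h} * attachDetachProb l1 l2 m2 (h (Fin.last t)) y := by
  have key : ∀ ω, (∀ s ≤ t, d s ω = h ⟨min s t, by omega⟩) ↔ history d t ω = h := by
    intro ω
    constructor
    · intro H
      ext1 s
      have hs : (s : ℕ) ≤ t := by omega
      rw [history, H s hs]
      congr 1
      exact Fin.ext (min_eq_left hs)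
    · intro H s hs
      rw [← H, history]
      simp [min_eq_left hs]
  have hm := hd.markov t (fun s => h ⟨min s t, by omega⟩) y
  simp only [key] at hm
  rw [hm]
  congr 3
  exact Fin.ext (min_self t)

variable [IsProbabilityMeasure P]

theorem integrable_of_history {t : ℕ} (hd : IsAttachDetachChain l1 l2 m2 P d)
    {g : (Fin (t + 1) → InDegreeState) → ℝ} {B : ℝ} (hg : ∀ h, |g h| ≤ B) :
    Integrable (fun ω => g (history d t ω)) P :=
  Integrable.of_bound (((measurable_of_countable g).comp
    (measurable_history hd t)).aestronglyMeasurable) B (Eventually.of_forall fun _ => hg _)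

theorem integrable_of_state (hd : IsAttachDetachChain l1 l2 m2 P d) (t : ℕ)
    {F : InDegreeState → ℝ} {B : ℝ} (hF : ∀ x, |F x| ≤ B) :
    Integrable (fun ω => F (d t ω)) P :=
  Integrable.of_bound (((measurable_of_countable F).comp
    (hd.measurable t)).aestronglyMeasurable) B (Eventually.of_forall fun _ => hF _)

/-- The Markov property, for bounded test functions of the past and of the next state. -/
theorem integral_history_mul (hl1 : 0 < l1) (hl2 : 0 < l2) (hm2 : 0 ≤ m2)
    (hd : IsAttachDetachChain l1 l2 m2 P d) (t : ℕ)
    {g : (Fin (t + 1) → InDegreeState) → ℝ} {F : InDegreeState → ℝ} {B C : ℝ}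
    (hg : ∀ h, |g h| ≤ B) (hF : ∀ x, |F x| ≤ C) :
    ∫ ω, g (history d t ω) * F (d (t + 1) ω) ∂P =
      ∫ ω, g (history d t ω) * stepMean l1 l2 m2 F (d t ω) ∂P := by
  have hB : 0 ≤ B := (abs_nonneg _).trans (hg fun _ => InDegreeState.start)
  have hmeas : Measurable fun ω => (history d t ω, d (t + 1) ω) :=
    (measurable_history hd t).prodMk (hd.measurable (t + 1))
  have hbound : ∀ p : (Fin (t + 1) → InDegreeState) × InDegreeState,
      ‖g p.1 * F p.2‖ ≤ B * C := fun p => by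
    rw [Real.norm_eq_abs, abs_mul]
    exact mul_le_mul (hg _) (hF _) (abs_nonneg _) hB
  have hint : Integrable (fun p : (Fin (t + 1) → InDegreeState) × InDegreeState => g p.1 * F p.2)
      (P.map fun ω => (history d t ω, d (t + 1) ω)) := by
    have := Measure.isProbabilityMeasure_map (μ := P) hmeas.aemeasurable
    exact Integrable.of_bound (measurable_of_countable _).aestronglyMeasurable (B * C)
      (Eventually.of_forall hbound)
  have hint2 : Integrable (fun h : Fin (t + 1) → InDegreeState =>
      g h * stepMean l1 l2 m2 F (h (Fin.last t))) (P.map (history d t)) := by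
    have := Measure.isProbabilityMeasure_map (μ := P) (measurable_history hd t).aemeasurable
    refine Integrable.of_bound (measurable_of_countable _).aestronglyMeasurable (B * C)
      (Eventually.of_forall fun h => ?_)
    rw [Real.norm_eq_abs, abs_mul]
    exact mul_le_mul (hg _) (abs_stepMean_le hl1 hl2 hm2 hF _) (abs_nonneg _) hB
  have e1 : ∫ ω, g (history d t ω) * F (d (t + 1) ω) ∂P =
      ∫ p, g p.1 * F p.2 ∂(P.map fun ω => (history d t ω, d (t + 1) ω)) :=
    (integral_map (f := fun p : (Fin (t + 1) → InDegreeState) × InDegreeState => g p.1 * F p.2)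
      hmeas.aemeasurable (measurable_of_countable _).aestronglyMeasurable).symm
  have e2 : ∫ ω, g (history d t ω) * stepMean l1 l2 m2 F (d t ω) ∂P =
      ∫ h, g h * stepMean l1 l2 m2 F (h (Fin.last t)) ∂(P.map (history d t)) :=
    (integral_map (f := fun h : Fin (t + 1) → InDegreeState =>
      g h * stepMean l1 l2 m2 F (h (Fin.last t))) (measurable_history hd t).aemeasurable
      (measurable_of_countable _).aestronglyMeasurable).symm
  rw [e1, e2, integral_countable hint, integral_countable hint2]
  have hsum : Summable fun p : (Fin (t + 1) → InDegreeState) × InDegreeState =>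
      (P.map fun ω => (history d t ω, d (t + 1) ω)).real {p} • (g p.1 * F p.2) := by
    have h := hint
    rw [← Measure.sum_smul_dirac (P.map fun ω => (history d t ω, d (t + 1) ω))] at h
    refine (hasSum_integral_measure h).summable.congr fun p => ?_
    rw [integral_smul_measure, integral_dirac, measureReal_def]
  rw [hsum.tsum_prod]
  refine tsum_congr fun h => ?_
  have h1 : ∀ y, (P.map fun ω => (history d t ω, d (t + 1) ω)).real {(h, y)} •
      (g h * F y) = P.real {ω | history d t ω = h} * g h *
        (attachDetachProb l1 l2 m2 (h (Fin.last t)) y * F y) := by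
    intro y
    rw [map_measureReal_apply hmeas (measurableSet_singleton _), smul_eq_mul]
    have : (fun ω => (history d t ω, d (t + 1) ω)) ⁻¹' {(h, y)} =
        {ω | history d t ω = h ∧ d (t + 1) ω = y} := by
      ext ω; simp
    rw [this, measureReal_history_inter hd]
    ring
  simp only [h1]
  rw [tsum_mul_left, (hasSum_attachDetachProb_mul F _).tsum_eq,
    map_measureReal_apply (measurable_history hd t) (measurableSet_singleton _), smul_eq_mul]
  have : history d t ⁻¹' {h} = {ω | history d t ω = h} := rfl
  rw [this]
  ring

theorem integral_step (hl1 : 0 < l1) (hl2 : 0 < l2) (hm2 : 0 ≤ m2)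
    (hd : IsAttachDetachChain l1 l2 m2 P d) (t : ℕ) {F : InDegreeState → ℝ} {C : ℝ}
    (hF : ∀ x, |F x| ≤ C) :
    ∫ ω, F (d (t + 1) ω) ∂P = ∫ ω, stepMean l1 l2 m2 F (d t ω) ∂P := by
  simpa using integral_history_mul hl1 hl2 hm2 hd t (g := fun _ => 1) (B := 1) (by simp) hF

/-- The steps of the chain are almost surely possible ones. -/
theorem ae_attachDetachProb_ne_zero (hl1 : 0 < l1) (hl2 : 0 < l2) (hm2 : 0 ≤ m2)
    (hd : IsAttachDetachChain l1 l2 m2 P d) :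
    ∀ᵐ ω ∂P, ∀ t, attachDetachProb l1 l2 m2 (d t ω) (d (t + 1) ω) ≠ 0 := by
  classical
  rw [ae_all_iff]
  intro t
  have key : ∀ x y, attachDetachProb l1 l2 m2 x y = 0 →
      ∀ᵐ ω ∂P, ¬(d t ω = x ∧ d (t + 1) ω = y) := by
    intro x y hxy
    have h := integral_history_mul hl1 hl2 hm2 hd t
      (g := fun h => if h (Fin.last t) = x then 1 else 0)
      (F := fun z => if z = y then 1 else 0) (B := 1) (C := 1)
      (fun h => by split_ifs <;> simp) (fun z => by split_ifs <;> simp)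
    have hs : stepMean l1 l2 m2 (fun z => if z = y then 1 else 0) x = 0 := by
      refine (hasSum_attachDetachProb_mul _ x).unique ?_
      convert! hasSum_zero with z
      by_cases hz : z = y
      · rw [hz, hxy, zero_mul]
      · rw [if_neg hz, mul_zero]
    have hr : ∫ ω, (if history d t ω (Fin.last t) = x then (1 : ℝ) else 0) *
        stepMean l1 l2 m2 (fun z => if z = y then 1 else 0) (d t ω) ∂P = 0 := by
      refine integral_eq_zero_of_ae (Eventually.of_forall fun ω => ?_)
      simp only [Pi.zero_apply]
      split_ifs with hx
      · have : d t ω = x := hx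
        rw [this, hs, mul_zero]
      · rw [zero_mul]
    rw [hr, integral_eq_zero_iff_of_nonneg (fun ω => by positivity)] at h
    · filter_upwards [h] with ω hω hcon
      have h1 : history d t ω (Fin.last t) = x := hcon.1
      simp [h1, hcon.2] at hω
    · refine Integrable.of_bound (Measurable.aestronglyMeasurable ?_) 1
        (Eventually.of_forall fun ω => ?_)
      · exact ((measurable_of_countable (fun h : Fin (t + 1) → InDegreeState =>
          if h (Fin.last t) = x then (1 : ℝ) else 0)).comp (measurable_history hd t)).mul
          ((measurable_of_countable (fun z : InDegreeState =>
          if z = y then (1 : ℝ) else 0)).comp (hd.measurable (t + 1)))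
      · split_ifs <;> simp
  have hall : ∀ᵐ ω ∂P, ∀ x y, attachDetachProb l1 l2 m2 x y = 0 →
      ¬(d t ω = x ∧ d (t + 1) ω = y) := by
    rw [ae_all_iff]; intro x
    rw [ae_all_iff]; intro y
    by_cases h : attachDetachProb l1 l2 m2 x y = 0
    · filter_upwards [key x y h] with ω hω _ using hω
    · exact Eventually.of_forall fun ω h' => absurd h' h
  filter_upwards [hall] with ω hω h0
  exact hω _ _ h0 ⟨rfl, rfl⟩

/-- The expected total of the conditional variances is finite: `1 / ℓ` decreases in mean by
`λ₁ / (Z (ℓ + 1))` in each step. -/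
theorem sum_integral_inv_rate_le (hl1 : 0 < l1) (hl2 : 0 < l2) (hm2 : 0 ≤ m2)
    (hd : IsAttachDetachChain l1 l2 m2 P d) (t : ℕ) :
    ∑ s ∈ Finset.range t, ∫ ω, (rate l1 l2 m2 (d s ω))⁻¹ * (((d s ω).len : ℝ) + 1)⁻¹ ∂P ≤
      l1⁻¹ := by
  have hb : ∀ x : InDegreeState, |(x.len : ℝ)⁻¹| ≤ 1 := fun x => by
    have hL : (1 : ℝ) ≤ x.len := by exact_mod_cast x.len_pos
    rw [abs_of_nonneg (by positivity)]
    exact inv_le_one_of_one_le₀ hL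
  have hstep : ∀ s, ∫ ω, (rate l1 l2 m2 (d s ω))⁻¹ * (((d s ω).len : ℝ) + 1)⁻¹ ∂P =
      l1⁻¹ * (∫ ω, ((d s ω).len : ℝ)⁻¹ ∂P - ∫ ω, ((d (s + 1) ω).len : ℝ)⁻¹ ∂P) := by
    intro s
    rw [integral_step hl1 hl2 hm2 hd s hb, ← integral_sub (integrable_of_state hd s hb)
      (integrable_of_state hd s (abs_stepMean_le hl1 hl2 hm2 hb)), ← integral_const_mul]
    congr 1
    ext ω
    have := stepMean_inv_len_sub hl1 hl2 hm2 (d s ω)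
    rw [← neg_sub, this]
    field_simp
  simp only [hstep]
  rw [← Finset.mul_sum, Finset.sum_range_sub' (fun s => ∫ ω, ((d s ω).len : ℝ)⁻¹ ∂P)]
  refine mul_le_of_le_one_right (by positivity) ?_
  have h1 : ∫ ω, ((d 0 ω).len : ℝ)⁻¹ ∂P ≤ 1 := by
    have := integral_mono (integrable_of_state hd 0 hb) (integrable_const (1 : ℝ))
      (fun ω => (le_abs_self _).trans (hb (d 0 ω)))
    simpa using this
  have h2 : 0 ≤ ∫ ω, ((d t ω).len : ℝ)⁻¹ ∂P := integral_nonneg fun ω => by positivity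
  linarith

/-- If the one-step mean square displacement of a bounded `F` is of order `1 / (Z ℓ)`, then
`F` along the chain differs from its accumulated drift by an almost surely convergent sequence,
namely a martingale bounded in `L²`. -/
theorem ae_tendsto_sub_sum_drift (hl1 : 0 < l1) (hl2 : 0 < l2) (hm2 : 0 ≤ m2)
    (hd : IsAttachDetachChain l1 l2 m2 P d) {F : InDegreeState → ℝ} {B C : ℝ} (hC : 0 ≤ C)
    (hF : ∀ x, |F x| ≤ B)
    (hV : ∀ x, stepMean l1 l2 m2 (fun y => (F y - F x) ^ 2) x ≤
      C * ((rate l1 l2 m2 x)⁻¹ * ((x.len : ℝ) + 1)⁻¹)) :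
    ∀ᵐ ω ∂P, ∃ c, Tendsto (fun t => F (d t ω) -
      ∑ s ∈ Finset.range t, (stepMean l1 l2 m2 F (d s ω) - F (d s ω))) atTop (𝓝 c) := by
  have hB : 0 ≤ B := (abs_nonneg _).trans (hF InDegreeState.start)
  have hQ := abs_stepMean_le hl1 hl2 hm2 hF
  set m : (t : ℕ) → (Fin (t + 1) → InDegreeState) → ℝ := fun t h => F (h (Fin.last t)) -
    ∑ s : Fin t, (stepMean l1 l2 m2 F (h s.castSucc) - F (h s.castSucc)) with hm
  set M : ℕ → Ω → ℝ := fun t ω => m t (history d t ω) with hM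
  have hMdef : ∀ t ω, M t ω = F (d t ω) -
      ∑ s ∈ Finset.range t, (stepMean l1 l2 m2 F (d s ω) - F (d s ω)) := by
    intro t ω
    rw [Finset.sum_range]
    rfl
  have hMs : ∀ t ω, M (t + 1) ω = M t ω - stepMean l1 l2 m2 F (d t ω) + F (d (t + 1) ω) := by
    intro t ω
    rw [hMdef, hMdef, Finset.sum_range_succ]
    ring
  have hmB : ∀ t h, |m t h| ≤ B + t * (B + B) := by
    intro t h
    refine (abs_sub _ _).trans (add_le_add (hF _) ?_)
    refine (Finset.abs_sum_le_sum_abs _ _).trans ?_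
    refine (Finset.sum_le_sum fun s _ => (abs_sub _ _).trans (add_le_add (hQ _) (hF _))).trans ?_
    simp [mul_add]
  have hMint : ∀ t, Integrable (M t) P := fun t => integrable_of_history hd (hmB t)
  have hM2int : ∀ t, Integrable (fun ω => M t ω ^ 2) P := fun t =>
    integrable_of_history hd (g := fun h => m t h ^ 2) (B := (B + t * (B + B)) ^ 2) fun h => by
      rw [abs_pow]; exact pow_le_pow_left₀ (abs_nonneg _) (hmB t h) 2
  have hmart : Martingale M (chainFiltration hd) P := by
    refine martingale_of_setIntegral_eq_succ (fun t => ?_) hMint fun t s hs => ?_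
    · exact ((measurable_of_countable (m t)).comp (comap_measurable _)).stronglyMeasurable
    · obtain ⟨A, -, rfl⟩ := hs
      have hA : MeasurableSet (history d t ⁻¹' A) :=
        measurable_history hd t A.to_countable.measurableSet
      have h1 := integral_history_mul hl1 hl2 hm2 hd t (g := A.indicator fun _ => 1) (B := 1)
        (fun h => by by_cases hA : h ∈ A <;> simp [hA]) hF
      have e : ∀ G : Ω → ℝ, ∫ ω, A.indicator (fun _ => (1 : ℝ)) (history d t ω) * G ω ∂P =
          ∫ ω in history d t ⁻¹' A, G ω ∂P := by
        intro G
        rw [← integral_indicator hA]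
        congr 1
        ext ω
        by_cases hω : history d t ω ∈ A <;> simp [hω, Set.indicator]
      rw [e, e] at h1
      have i1 := (integrable_of_state hd (t + 1) hF).integrableOn (s := history d t ⁻¹' A)
      have i2 := (integrable_of_state hd t hQ).integrableOn (s := history d t ⁻¹' A)
      have i3 := (hMint t).integrableOn (s := history d t ⁻¹' A)
      have i4 : IntegrableOn (fun ω => M t ω - stepMean l1 l2 m2 F (d t ω))
        (history d t ⁻¹' A) P := i3.sub i2
      simp only [hMs]
      rw [integral_add i4 i1, integral_sub i3 i2, h1]
      ring
  -- orthogonality of the increments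
  have hvar : ∀ t, ∫ ω, M (t + 1) ω ^ 2 ∂P ≤ ∫ ω, M t ω ^ 2 ∂P +
      C * ∫ ω, (rate l1 l2 m2 (d t ω))⁻¹ * (((d t ω).len : ℝ) + 1)⁻¹ ∂P := by
    intro t
    set k : (Fin (t + 1) → InDegreeState) → ℝ := fun h =>
      m t h - stepMean l1 l2 m2 F (h (Fin.last t)) with hk
    have hkB : ∀ h, |k h| ≤ B + t * (B + B) + B := fun h =>
      (abs_sub _ _).trans (add_le_add (hmB t h) (hQ _))
    have hF2 : ∀ x, |F x ^ 2| ≤ B ^ 2 := fun x => by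
      rw [abs_pow]; exact pow_le_pow_left₀ (abs_nonneg _) (hF x) 2
    have hQ2 := abs_stepMean_le hl1 hl2 hm2 hF2
    have i1 : Integrable (fun ω => k (history d t ω) ^ 2) P :=
      integrable_of_history hd (g := fun h => k h ^ 2) (B := (B + t * (B + B) + B) ^ 2) fun h => by
        rw [abs_pow]; exact pow_le_pow_left₀ (abs_nonneg _) (hkB h) 2
    have i2 : Integrable (fun ω => k (history d t ω) * F (d (t + 1) ω)) P :=
      (integrable_of_state hd (t + 1) hF).bdd_mul
        ((measurable_of_countable k).comp (measurable_history hd t)).aestronglyMeasurable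
        (Eventually.of_forall fun ω => hkB _)
    have i3 : Integrable (fun ω => k (history d t ω) * stepMean l1 l2 m2 F (d t ω)) P :=
      (integrable_of_state hd t hQ).bdd_mul
        ((measurable_of_countable k).comp (measurable_history hd t)).aestronglyMeasurable
        (Eventually.of_forall fun ω => hkB _)
    have i4 := integrable_of_state hd (t + 1) hF2
    have i5 := integrable_of_state hd t hQ2
    have hw : ∀ x : InDegreeState, |(rate l1 l2 m2 x)⁻¹ * ((x.len : ℝ) + 1)⁻¹| ≤ l1⁻¹ := by
      intro x
      have hZ := rate_pos hl1 hl2 hm2 x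
      have hL : (1 : ℝ) ≤ x.len := by exact_mod_cast x.len_pos
      rw [abs_of_nonneg (by positivity)]
      have hr : l1 ≤ rate l1 l2 m2 x := by
        have : (0 : ℝ) ≤ (l2 + m2) * x.total := by positivity
        unfold rate
        nlinarith
      have h2 : ((x.len : ℝ) + 1)⁻¹ ≤ 1 := inv_le_one_of_one_le₀ (by linarith)
      calc (rate l1 l2 m2 x)⁻¹ * ((x.len : ℝ) + 1)⁻¹ ≤ l1⁻¹ * 1 := by gcongr
        _ = l1⁻¹ := mul_one _
    have i6 := integrable_of_state hd t hw
    have i7 : Integrable (fun ω => k (history d t ω) ^ 2 +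
        2 * (k (history d t ω) * F (d (t + 1) ω))) P := i1.add (i2.const_mul 2)
    have i8 : Integrable (fun ω => k (history d t ω) ^ 2 +
        2 * (k (history d t ω) * stepMean l1 l2 m2 F (d t ω))) P := i1.add (i3.const_mul 2)
    have e1 : ∫ ω, M (t + 1) ω ^ 2 ∂P = ∫ ω, (k (history d t ω) ^ 2 +
        2 * (k (history d t ω) * stepMean l1 l2 m2 F (d t ω)) +
        stepMean l1 l2 m2 (fun y => F y ^ 2) (d t ω)) ∂P := by
      have : ∀ ω, M (t + 1) ω ^ 2 = k (history d t ω) ^ 2 +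
          2 * (k (history d t ω) * F (d (t + 1) ω)) + F (d (t + 1) ω) ^ 2 := by
        intro ω
        have : M (t + 1) ω = k (history d t ω) + F (d (t + 1) ω) := hMs t ω
        rw [this]; ring
      simp only [this]
      rw [integral_add i7 i4, integral_add i1 (i2.const_mul 2),
        integral_add i8 i5, integral_add i1 (i3.const_mul 2),
        integral_const_mul, integral_const_mul, integral_history_mul hl1 hl2 hm2 hd t hkB hF,
        integral_step hl1 hl2 hm2 hd t hF2]
    rw [e1, ← integral_const_mul, ← integral_add (hM2int t) (i6.const_mul C)]
    refine integral_mono (i8.add i5) ((hM2int t).add (i6.const_mul C))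
      fun ω => ?_
    have h1 := (stepMean_sq_sub_sq_le hl1 hl2 hm2 F (d t ω)).trans (hV (d t ω))
    have h2 : M t ω = k (history d t ω) + stepMean l1 l2 m2 F (d t ω) := by
      simp only [hk, hM]
      have : history d t ω (Fin.last t) = d t ω := rfl
      rw [this]; ring
    simp only
    rw [h2]
    nlinarith
  have hL2 : ∀ t, ∫ ω, M t ω ^ 2 ∂P ≤ B ^ 2 + C * ∑ s ∈ Finset.range t,
      ∫ ω, (rate l1 l2 m2 (d s ω))⁻¹ * (((d s ω).len : ℝ) + 1)⁻¹ ∂P := by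
    intro t
    induction t with
    | zero =>
      have := integral_mono (hM2int 0) (integrable_const (B ^ 2)) fun ω => by
        have h1 := hmB 0 (history d 0 ω)
        rw [Nat.cast_zero, zero_mul, add_zero] at h1
        exact sq_le_sq' (abs_le.1 h1).1 (abs_le.1 h1).2
      simpa using this
    | succ t ih =>
      rw [Finset.sum_range_succ, mul_add]
      linarith [hvar t]
  have hL2' : ∀ t, ∫ ω, M t ω ^ 2 ∂P ≤ B ^ 2 + C * l1⁻¹ := fun t =>
    (hL2 t).trans (by
      have := mul_le_mul_of_nonneg_left (sum_integral_inv_rate_le hl1 hl2 hm2 hd t) hC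
      linarith)
  have hL1 : ∀ t, eLpNorm (M t) 1 P ≤ (Real.toNNReal (1 + (B ^ 2 + C * l1⁻¹)) : ℝ≥0∞) := by
    intro t
    rw [eLpNorm_one_eq_lintegral_enorm, ← ofReal_integral_norm_eq_lintegral_enorm (hMint t)]
    refine ENNReal.ofReal_le_ofReal ?_
    have h1 : ∫ ω, ‖M t ω‖ ∂P ≤ ∫ ω, (1 + M t ω ^ 2) ∂P := by
      refine integral_mono (hMint t).norm ((integrable_const 1).add (hM2int t)) fun ω => ?_
      simp only [Real.norm_eq_abs]
      nlinarith [sq_nonneg (|M t ω| - 1), sq_abs (M t ω), abs_nonneg (M t ω)]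
    rw [integral_add (integrable_const 1) (hM2int t)] at h1
    have h2 := hL2' t
    simp only [integral_const, probReal_univ, smul_eq_mul, mul_one] at h1
    linarith
  filter_upwards [hmart.submartingale.exists_ae_tendsto_of_bdd hL1] with ω ⟨c, hc⟩
  exact ⟨c, hc.congr fun t => hMdef t ω⟩

end Chain

/-! ### Almost sure convergence of the empirical in-degree tails -/

/-- The indicator function of the in-degrees of at least `j`. -/
def tailIndicator (j k : ℕ) : ℝ := if j ≤ k then 1 else 0

theorem tailIndicator_nonneg (j k : ℕ) : 0 ≤ tailIndicator j k := by
  unfold tailIndicator; split_ifs <;> norm_num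

theorem tailIndicator_le_one (j k : ℕ) : tailIndicator j k ≤ 1 := by
  unfold tailIndicator; split_ifs <;> norm_num

theorem tailIndicator_succ_add_one_sub (j k : ℕ) :
    tailIndicator (j + 1) (k + 1) - tailIndicator (j + 1) k = if k = j then 1 else 0 := by
  unfold tailIndicator
  split_ifs <;> first | omega | norm_num

theorem mul_tailIndicator_succ_sub_one_sub (j k : ℕ) :
    (k : ℝ) * (tailIndicator (j + 1) (k - 1) - tailIndicator (j + 1) k) =
      if k = j + 1 then -((j : ℝ) + 1) else 0 := by
  unfold tailIndicator
  rcases k with _ | k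
  · simp
  · split_ifs with h1 h2 h3 h4 <;> first | omega | simp_all

theorem tailIndicator_sub_succ (j k : ℕ) :
    tailIndicator j k - tailIndicator (j + 1) k = if k = j then 1 else 0 := by
  unfold tailIndicator
  split_ifs <;> first | omega | norm_num

section Convergence

variable {l1 l2 m2 : ℝ}

theorem entryMean_tailIndicator_nonneg (j : ℕ) (x : InDegreeState) :
    0 ≤ entryMean (tailIndicator j) x :=
  div_nonneg (Finset.sum_nonneg fun _ _ => tailIndicator_nonneg _ _) (Nat.cast_nonneg _)

theorem entryMean_tailIndicator_le_one (j : ℕ) (x : InDegreeState) :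
    entryMean (tailIndicator j) x ≤ 1 :=
  (le_abs_self _).trans (abs_entryMean_le (fun k => abs_le.2
    ⟨by linarith [tailIndicator_nonneg j k], tailIndicator_le_one j k⟩) x)

theorem entryMean_tailIndicator_zero (x : InDegreeState) : entryMean (tailIndicator 0) x = 1 := by
  have : (x.len : ℝ) ≠ 0 := by exact_mod_cast x.len_pos.ne'
  simp [entryMean, entrySum, tailIndicator, this]

/-- The birth-death generator acts on tails through the dual birth-death chain. -/
theorem entryMean_generator_tailIndicator (j : ℕ) (x : InDegreeState) :
    entryMean (fun k => l2 * k * (tailIndicator (j + 1) (k + 1) - tailIndicator (j + 1) k) +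
      m2 * k * (tailIndicator (j + 1) (k - 1) - tailIndicator (j + 1) k)) x =
    l2 * j * (entryMean (tailIndicator j) x - entryMean (tailIndicator (j + 1)) x) -
      m2 * (j + 1) * (entryMean (tailIndicator (j + 1)) x -
        entryMean (tailIndicator (j + 2)) x) := by
  have h : (fun k : ℕ => l2 * k * (tailIndicator (j + 1) (k + 1) - tailIndicator (j + 1) k) +
      m2 * k * (tailIndicator (j + 1) (k - 1) - tailIndicator (j + 1) k)) =
      fun k => l2 * j * (tailIndicator j k - tailIndicator (j + 1) k) -
        m2 * (j + 1) * (tailIndicator (j + 1) k - tailIndicator (j + 2) k) := by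
    ext k
    rw [mul_assoc m2, mul_tailIndicator_succ_sub_one_sub, tailIndicator_succ_add_one_sub,
      tailIndicator_sub_succ, tailIndicator_sub_succ]
    split_ifs with h1 h2 h2
    · omega
    · subst h1; ring
    · ring
    · ring
  rw [h]
  simp only [entryMean, entrySum, Finset.sum_sub_distrib, ← Finset.mul_sum]
  ring

theorem tailIndicator_sq_le (hl2 : 0 < l2) (hm2 : 0 ≤ m2) (j k : ℕ) :
    l2 * k * (tailIndicator (j + 1) (k + 1) - tailIndicator (j + 1) k) ^ 2 +
      m2 * k * (tailIndicator (j + 1) (k - 1) - tailIndicator (j + 1) k) ^ 2 ≤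
      l2 * j + m2 * (j + 1) := by
  have h1 : (tailIndicator (j + 1) (k - 1) - tailIndicator (j + 1) k) ^ 2 ≤ 1 := by
    rw [sq_le_one_iff_abs_le_one, abs_le]
    constructor <;> linarith [tailIndicator_nonneg (j + 1) (k - 1), tailIndicator_nonneg (j + 1) k,
      tailIndicator_le_one (j + 1) (k - 1), tailIndicator_le_one (j + 1) k]
  have h2 : m2 * k * (tailIndicator (j + 1) (k - 1) - tailIndicator (j + 1) k) ^ 2 ≤
      m2 * (j + 1) := by
    by_cases hk : k = j + 1
    · subst hk
      push_cast
      exact mul_le_of_le_one_right (by positivity) h1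
    · have h3 := mul_tailIndicator_succ_sub_one_sub j k
      rw [if_neg hk] at h3
      rw [sq, mul_assoc, ← mul_assoc (k : ℝ), h3]
      simp only [zero_mul, mul_zero]
      positivity
  rw [tailIndicator_succ_add_one_sub]
  split_ifs with h
  · subst h; linarith
  · have : 0 ≤ l2 * (j : ℝ) := by positivity
    linarith

variable {Ω : Type*} [MeasurableSpace Ω] {P : Measure Ω} [IsProbabilityMeasure P]
  {d : ℕ → Ω → InDegreeState}

/-- The chain in its own clock: the continuous-time chain waits `1 / Z` on average in each state,
and these waiting times have infinite sum, because `Z` grows at most linearly. -/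
theorem tendsto_sum_inv_rate (hl1 : 0 < l1) (hl2 : 0 < l2) (hm2 : 0 ≤ m2)
    {x : ℕ → InDegreeState} (h0 : x 0 = InDegreeState.start)
    (hx : ∀ t, attachDetachProb l1 l2 m2 (x t) (x (t + 1)) ≠ 0) :
    Tendsto (fun t => ∑ s ∈ Finset.range t, (rate l1 l2 m2 (x s))⁻¹) atTop atTop := by
  have hlen : ∀ t, (x t).len ≤ t + 1 ∧ (x t).total ≤ t + 1 := by
    intro t
    induction t with
    | zero => rw [h0]; simp [InDegreeState.start, len, total]
    | succ t ih =>
      obtain ⟨-, h2, h3⟩ := attachDetachProb_ne_zero (hx t)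
      omega
  have h1 : Tendsto (fun t => (l2 + m2 + l1)⁻¹ * ∑ s ∈ Finset.range t, 1 / ((s : ℝ) + 1))
      atTop atTop := Real.tendsto_sum_range_one_div_nat_succ_atTop.const_mul_atTop (by positivity)
  refine tendsto_atTop_mono (fun t => ?_) h1
  rw [Finset.mul_sum]
  refine Finset.sum_le_sum fun s _ => ?_
  have hZ := rate_pos hl1 hl2 hm2 (x s)
  rw [one_div, ← mul_inv]
  refine inv_anti₀ hZ ?_
  have h2 : ((x s).len : ℝ) ≤ s + 1 := by exact_mod_cast (hlen s).1
  have h3 : ((x s).total : ℝ) ≤ s + 1 := by exact_mod_cast (hlen s).2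
  calc rate l1 l2 m2 (x s) ≤ (l2 + m2) * (s + 1) + (s + 1) * l1 := by unfold rate; gcongr
    _ = _ := by ring

theorem tendsto_inv_rate (hl1 : 0 < l1) (hl2 : 0 < l2) (hm2 : 0 ≤ m2) {x : ℕ → InDegreeState}
    (hmono : Monotone fun t => (x t).len)
    (hsum : Tendsto (fun t => ∑ s ∈ Finset.range t, (rate l1 l2 m2 (x s))⁻¹) atTop atTop)
    (hw : Summable fun s => (rate l1 l2 m2 (x s))⁻¹ * (((x s).len : ℝ) + 1)⁻¹) :
    Tendsto (fun t => (rate l1 l2 m2 (x t))⁻¹) atTop (𝓝 0) := by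
  have hlen : Tendsto (fun t => (x t).len) atTop atTop := by
    refine tendsto_atTop_atTop_of_monotone hmono fun K => ?_
    -- a bounded number of vertices would make the clock finite
    by_contra! hK
    refine not_tendsto_atTop_of_tendsto_nhds (hw.mul_left ((K : ℝ) + 1)).hasSum.tendsto_sum_nat
      (tendsto_atTop_mono (fun t => Finset.sum_le_sum fun s _ => ?_) hsum)
    have hZ := rate_pos hl1 hl2 hm2 (x s)
    have h1 : ((x s).len : ℝ) ≤ K := by exact_mod_cast (hK s).le
    have h2 : 1 ≤ ((K : ℝ) + 1) * (((x s).len : ℝ) + 1)⁻¹ := by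
      rw [← div_eq_mul_inv, one_le_div (by positivity)]; linarith
    calc (rate l1 l2 m2 (x s))⁻¹ = (rate l1 l2 m2 (x s))⁻¹ * 1 := (mul_one _).symm
      _ ≤ (rate l1 l2 m2 (x s))⁻¹ * (((K : ℝ) + 1) * (((x s).len : ℝ) + 1)⁻¹) := by gcongr
      _ = _ := by ring
  have hlim : Tendsto (fun t => l1⁻¹ * (((x t).len : ℝ))⁻¹) atTop (𝓝 0) := by
    simpa using (tendsto_inv_atTop_zero.comp
      (tendsto_natCast_atTop_atTop.comp hlen)).const_mul l1⁻¹
  refine squeeze_zero (fun t => (inv_pos.2 (rate_pos hl1 hl2 hm2 _)).le) (fun t => ?_) hlim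
  have hL : (0 : ℝ) < (x t).len := by exact_mod_cast (x t).len_pos
  rw [← mul_inv]
  refine inv_anti₀ (by positivity) ?_
  have : 0 ≤ (l2 + m2) * ((x t).total : ℝ) := by positivity
  unfold rate
  linarith

theorem ae_tendsto_entryMean_tail (hl1 : 0 < l1) (hl2 : 0 < l2) (hm2 : 0 ≤ m2)
    (hd : IsAttachDetachChain l1 l2 m2 P d) :
    ∀ᵐ ω ∂P, ∀ j, Tendsto (fun t => entryMean (tailIndicator j) (d t ω)) atTop
      (𝓝 (inDegreeTail l1 l2 m2 j)) := by
  have hstart : ∀ᵐ ω ∂P, d 0 ω = InDegreeState.start := by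
    have hms : MeasurableSet {ω | d 0 ω = InDegreeState.start} :=
      hd.measurable 0 (measurableSet_singleton _)
    exact (mem_ae_iff_prob_eq_one hms).2 hd.initial
  have hlenmart := ae_tendsto_sub_sum_drift hl1 hl2 hm2 hd (F := fun y => (y.len : ℝ)⁻¹) (B := 1)
    hl1.le (fun x => by
      have hL : (1 : ℝ) ≤ x.len := by exact_mod_cast x.len_pos
      rw [abs_of_nonneg (by positivity)]
      exact inv_le_one_of_one_le₀ hL) (stepMean_inv_len_sq_le hl1 hl2 hm2)
  have htailmart : ∀ᵐ ω ∂P, ∀ j : ℕ, ∃ c, Tendsto (fun t =>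
      entryMean (tailIndicator (j + 1)) (d t ω) - ∑ s ∈ Finset.range t,
        (stepMean l1 l2 m2 (entryMean (tailIndicator (j + 1))) (d s ω) -
          entryMean (tailIndicator (j + 1)) (d s ω))) atTop (𝓝 c) := by
    rw [ae_all_iff]
    intro j
    have hC : 0 ≤ l2 * j + m2 * (j + 1) := by positivity
    refine ae_tendsto_sub_sum_drift hl1 hl2 hm2 hd (B := 1)
      (C := 2 * (l2 * j + m2 * (j + 1)) + l1) (by positivity) (fun x => ?_)
      (stepMean_entryMean_sq_le hl1 hl2 hm2 hC (tailIndicator_nonneg _) (tailIndicator_le_one _)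
        (tailIndicator_sq_le hl2 hm2 j))
    rw [abs_of_nonneg (entryMean_tailIndicator_nonneg _ _)]
    exact entryMean_tailIndicator_le_one _ _
  filter_upwards [hstart, ae_attachDetachProb_ne_zero hl1 hl2 hm2 hd, hlenmart, htailmart]
    with ω h0 hstep hlen htail
  have hsum := tendsto_sum_inv_rate hl1 hl2 hm2 (x := fun t => d t ω) h0 hstep
  have hmono : Monotone fun t => (d t ω).len :=
    monotone_nat_of_le_succ fun t => (attachDetachProb_ne_zero (hstep t)).1
  set a : ℕ → ℝ := fun t => (rate l1 l2 m2 (d t ω))⁻¹ with ha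
  have ha0 : ∀ t, 0 ≤ a t := fun t => (inv_pos.2 (rate_pos hl1 hl2 hm2 _)).le
  have hw : Summable fun s => a s * (((d s ω).len : ℝ) + 1)⁻¹ := by
    obtain ⟨c, hc⟩ := hlen
    simp only [stepMean_inv_len_sub hl1 hl2 hm2, Finset.sum_neg_distrib, sub_neg_eq_add,
      ← Finset.mul_sum] at hc
    obtain ⟨K, hK⟩ := hc.bddAbove_range
    refine summable_of_sum_range_le (c := K / l1)
      (fun s => mul_nonneg (ha0 s) (by positivity)) fun t => ?_
    have h1 := hK ⟨t, rfl⟩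
    have h2 : 0 ≤ ((d t ω).len : ℝ)⁻¹ := by positivity
    rw [le_div_iff₀' hl1]
    simp only [ha]
    linarith
  have hatend := tendsto_inv_rate hl1 hl2 hm2 (x := fun t => d t ω) hmono hsum hw
  intro j
  have hlim := tendsto_zero_of_dual_euler hl1 hl2.le hm2 (a := a)
    (y := fun j t => entryMean (tailIndicator j) (d t ω) - inDegreeTail l1 l2 m2 j) (B := 2)
    ha0 hatend hsum (fun t => by
      rw [entryMean_tailIndicator_zero, inDegreeTail_zero, sub_self]) (fun j t => ?_)
    (fun j => ?_) j
  · simpa using hlim.add_const (inDegreeTail l1 l2 m2 j)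
  · have := entryMean_tailIndicator_nonneg j (d t ω)
    have := entryMean_tailIndicator_le_one j (d t ω)
    have := inDegreeTail_nonneg hl1 hl2 hm2 j
    have := inDegreeTail_le_one hl1 hl2 hm2 j
    rw [abs_le]
    constructor <;> linarith
  · obtain ⟨c, hc⟩ := htail j
    -- the drift of `entryMean` differs from the dual equation by a summable sequence
    set e : ℕ → ℝ := fun s => l1 * (tailIndicator (j + 1) 1 -
      entryMean (tailIndicator (j + 1)) (d s ω)) * (a s * (((d s ω).len : ℝ) + 1)⁻¹) with he
    have hes : Summable e := by
      refine Summable.of_norm_bounded (hw.mul_left l1) fun s => ?_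
      have h1 : 0 ≤ a s * (((d s ω).len : ℝ) + 1)⁻¹ := mul_nonneg (ha0 s) (by positivity)
      have h2 : |tailIndicator (j + 1) 1 - entryMean (tailIndicator (j + 1)) (d s ω)| ≤ 1 := by
        rw [abs_le]
        constructor <;> linarith [tailIndicator_nonneg (j + 1) 1, tailIndicator_le_one (j + 1) 1,
          entryMean_tailIndicator_nonneg (j + 1) (d s ω),
          entryMean_tailIndicator_le_one (j + 1) (d s ω)]
      rw [Real.norm_eq_abs, he]
      simp only
      rw [abs_mul, abs_mul, abs_of_pos hl1, abs_of_nonneg h1]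
      calc l1 * |tailIndicator (j + 1) 1 - entryMean (tailIndicator (j + 1)) (d s ω)| *
            (a s * (((d s ω).len : ℝ) + 1)⁻¹) ≤ l1 * 1 * (a s * (((d s ω).len : ℝ) + 1)⁻¹) := by
            gcongr
        _ = _ := by rw [mul_one]
    refine ⟨c - inDegreeTail l1 l2 m2 (j + 1) - ∑' s, e s,
      ((hc.sub_const _).sub hes.hasSum.tendsto_sum_nat).congr fun t => ?_⟩
    have hterm : ∀ s, stepMean l1 l2 m2 (entryMean (tailIndicator (j + 1))) (d s ω) -
        entryMean (tailIndicator (j + 1)) (d s ω) =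
        a s * (l2 * j * (entryMean (tailIndicator j) (d s ω) - inDegreeTail l1 l2 m2 j) +
          m2 * (j + 1) * (entryMean (tailIndicator (j + 2)) (d s ω) -
            inDegreeTail l1 l2 m2 (j + 2)) -
          (l2 * j + m2 * (j + 1) + l1) * (entryMean (tailIndicator (j + 1)) (d s ω) -
            inDegreeTail l1 l2 m2 (j + 1))) - e s := by
      intro s
      have h1 := inDegreeTail_dual hl1 hl2 hm2 j
      have h2 : tailIndicator (j + 1) 1 = if j = 0 then 1 else 0 := by
        unfold tailIndicator; split_ifs <;> first | omega | rfl
      rw [stepMean_entryMean_sub hl1 hl2 hm2, entryMean_generator_tailIndicator]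
      simp only [he, ha]
      rw [sub_left_inj, h2]
      linear_combination (-(rate l1 l2 m2 (d s ω))⁻¹) * (-h1)
    simp only [hterm, Finset.sum_sub_distrib]
    ring

/-! ### The law of the in-degree of a uniform vertex -/

theorem entryMean_single_eq (j : ℕ) (x : InDegreeState) :
    entryMean (tailIndicator j) x - entryMean (tailIndicator (j + 1)) x =
      entryMean (fun k => if k = j then 1 else 0) x := by
  rw [entryMean, entryMean, entryMean, ← sub_div, entrySum, entrySum, entrySum,
    ← Finset.sum_sub_distrib]
  simp only [tailIndicator_sub_succ]

theorem measure_uniformVertex_eq {D : ℕ → Ω → ℕ} (hdm : ∀ t, Measurable (d t))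
    (hD : IsUniformVertexInDegree P d D) (t j : ℕ) :
    P {ω | D t ω = j} = ∫⁻ ω, ENNReal.ofReal
      (entryMean (tailIndicator j) (d t ω) - entryMean (tailIndicator (j + 1)) (d t ω)) ∂P := by
  classical
  set S : ℕ → Set Ω := fun n => {ω | (d t ω).len = n} with hS
  have hlen : Measurable fun ω => (d t ω).len :=
    (measurable_of_countable InDegreeState.len).comp (hdm t)
  have hSm : ∀ n, MeasurableSet (S n) := fun n => hlen (measurableSet_singleton n)
  have hA : ∀ i, MeasurableSet {ω | (d t ω).entry i = j} := fun i =>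
    ((measurable_of_countable fun x : InDegreeState => x.entry i).comp (hdm t))
      (measurableSet_singleton j)
  have hDm : MeasurableSet {ω | D t ω = j} := hD.measurable t (measurableSet_singleton j)
  have hdisj : Pairwise (Function.onFun Disjoint S) := fun m n hmn =>
    Set.disjoint_left.2 fun ω h1 h2 => hmn (h1.symm.trans h2)
  have hunion : ⋃ n, S n = Set.univ := Set.eq_univ_of_forall fun ω => Set.mem_iUnion.2 ⟨_, rfl⟩
  have hpiece : ∀ n, P (S n ∩ {ω | D t ω = j}) =
      (n : ℝ≥0∞)⁻¹ * ∑ i ∈ Finset.range n, P (S n ∩ {ω | (d t ω).entry i = j}) := by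
    intro n
    rcases Nat.eq_zero_or_pos n with rfl | hn
    · have : S 0 = ∅ := Set.eq_empty_of_forall_notMem fun ω h => (d t ω).len_pos.ne' h
      simp [this]
    · have hc : P[{ω | D t ω = j} | S n] = (n : ℝ≥0∞)⁻¹ * ∑ i ∈ Finset.range n,
          P[{ω | (d t ω).entry i = j} | S n] := hD.conditional t n j hn
      simp only [ProbabilityTheory.cond_apply (hSm n)] at hc
      by_cases h0 : P (S n) = 0
      · rw [measure_inter_null_of_null_left _ h0]
        simp [measure_inter_null_of_null_left _ h0]
      · have h1 := congrArg (P (S n) * ·) hc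
        simp only [← Finset.mul_sum] at h1
        rw [← mul_assoc, ENNReal.mul_inv_cancel h0 (measure_ne_top _ _), one_mul] at h1
        rw [h1, mul_left_comm, ← mul_assoc (P _), ENNReal.mul_inv_cancel h0 (measure_ne_top _ _),
          one_mul]
  have hintegrand : ∀ n, ∀ ω ∈ S n, ENNReal.ofReal
      (entryMean (tailIndicator j) (d t ω) - entryMean (tailIndicator (j + 1)) (d t ω)) =
      (n : ℝ≥0∞)⁻¹ * ∑ i ∈ Finset.range n,
        {ω | (d t ω).entry i = j}.indicator (fun _ => (1 : ℝ≥0∞)) ω := by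
    intro n ω hω
    have hω' : (d t ω).len = n := hω
    have hn : (0 : ℝ) < n := by
      have := (d t ω).len_pos
      rw [hω'] at this
      exact_mod_cast this
    rw [entryMean_single_eq, entryMean, entrySum, hω', ENNReal.ofReal_div_of_pos hn,
      ENNReal.ofReal_natCast, ENNReal.div_eq_inv_mul, ENNReal.ofReal_sum_of_nonneg]
    · congr 1
      refine Finset.sum_congr rfl fun i _ => ?_
      by_cases h : (d t ω).entry i = j <;> simp [h]
    · intro i _
      split_ifs <;> norm_num
  calc P {ω | D t ω = j} = ∑' n, P (S n ∩ {ω | D t ω = j}) := by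
        rw [← measure_iUnion (fun m n hmn => (hdisj hmn).mono Set.inter_subset_left
          Set.inter_subset_left) (fun n => (hSm n).inter hDm), ← Set.iUnion_inter, hunion,
          Set.univ_inter]
    _ = ∑' n, ∫⁻ ω in S n, ENNReal.ofReal (entryMean (tailIndicator j) (d t ω) -
          entryMean (tailIndicator (j + 1)) (d t ω)) ∂P := by
        refine tsum_congr fun n => ?_
        rw [setLIntegral_congr_fun (hSm n) (hintegrand n), lintegral_const_mul _
          (Finset.measurable_fun_sum _ fun i _ => measurable_const.indicator (hA i)),
          lintegral_finsetSum _ fun i _ => measurable_const.indicator (hA i), hpiece]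
        congr 1
        refine Finset.sum_congr rfl fun i _ => ?_
        rw [lintegral_indicator (hA i), setLIntegral_one, Measure.restrict_apply (hA i),
          Set.inter_comm]
    _ = _ := by
        rw [← lintegral_iUnion hSm hdisj, hunion, Measure.restrict_univ]

theorem tendsto_measure_uniformVertex (hl1 : 0 < l1) (hl2 : 0 < l2) (hm2 : 0 ≤ m2)
    (hd : IsAttachDetachChain l1 l2 m2 P d) {D : ℕ → Ω → ℕ}
    (hD : IsUniformVertexInDegree P d D) (j : ℕ) :
    Tendsto (fun t => P {ω | D t ω = j}) atTop (𝓝 (inDegreePMF hl1 hl2 hm2 j)) := by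
  have hmeas : ∀ t, Measurable fun ω => ENNReal.ofReal
      (entryMean (tailIndicator j) (d t ω) - entryMean (tailIndicator (j + 1)) (d t ω)) := fun t =>
    (measurable_of_countable fun x => ENNReal.ofReal
      (entryMean (tailIndicator j) x - entryMean (tailIndicator (j + 1)) x)).comp (hd.measurable t)
  have h : Tendsto (fun t => ∫⁻ ω, ENNReal.ofReal
      (entryMean (tailIndicator j) (d t ω) - entryMean (tailIndicator (j + 1)) (d t ω)) ∂P) atTop
      (𝓝 (∫⁻ _, inDegreePMF hl1 hl2 hm2 j ∂P)) := by
    refine tendsto_lintegral_of_dominated_convergence (fun _ => 1) hmeas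
      (fun t => Eventually.of_forall fun ω => ?_) (by simp) ?_
    · rw [← ENNReal.ofReal_one]
      refine ENNReal.ofReal_le_ofReal ?_
      linarith [entryMean_tailIndicator_nonneg (j + 1) (d t ω),
        entryMean_tailIndicator_le_one j (d t ω)]
    · filter_upwards [ae_tendsto_entryMean_tail hl1 hl2 hm2 hd] with ω hω
      rw [inDegreePMF_apply]
      exact ENNReal.tendsto_ofReal ((hω j).sub (hω (j + 1)))
  simpa only [measure_uniformVertex_eq hd.measurable hD, lintegral_const, measure_univ,
    mul_one] using h

end Convergence

theorem AsympEquiv.congr_left {f f' g : ℕ → ℝ} (h : AsympEquiv f g)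
    (hf : ∀ᶠ j in atTop, f j = f' j) :
    AsympEquiv f' g :=
  Tendsto.congr' (hf.mono fun j hj => by rw [hj]) h

theorem theorem1 {Ω : Type*} [MeasurableSpace Ω] (P : Measure Ω) [IsProbabilityMeasure P]
    (lam1 lam2 mu2 : ℝ) (hlam1 : 0 < lam1) (hlam2 : 0 < lam2) (hmu2 : 0 ≤ mu2)
    (d : ℕ → Ω → InDegreeState) (hd : IsAttachDetachChain lam1 lam2 mu2 P d)
    (D : ℕ → Ω → ℕ) (hD : IsUniformVertexInDegree P d D) :
    ∃ p : PMF ℕ,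
      (∀ j : ℕ, Tendsto (fun t => P {ω | D t ω = j}) atTop (𝓝 (p j))) ∧
      (mu2 = 0 →
        AsympEquiv (fun j => (p j).toReal) (fun j =>
          (lam1 / lam2 * Real.Gamma (1 + lam1 / lam2)) *
            (j : ℝ) ^ (-(1 + lam1 / lam2)))) ∧
      (0 < mu2 → mu2 < lam2 →
        AsympEquiv (fun j => (p j).toReal) (fun j =>
          (lam1 / lam2 * (lam2 / (lam2 - mu2)) ^ (lam1 / (lam2 - mu2)) *
              Real.Gamma (1 + lam1 / (lam2 - mu2))) *
            (j : ℝ) ^ (-(1 + lam1 / (lam2 - mu2))))) ∧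
      (0 < mu2 → lam2 < mu2 →
        AsympEquiv (fun j => (p j).toReal) (fun j =>
          (lam1 * mu2 / lam2 ^ 2 * (mu2 / (mu2 - lam2)) ^ (lam1 / (mu2 - lam2)) *
              Real.Gamma (1 + lam1 / (mu2 - lam2))) *
            (lam2 / mu2) ^ (j + 1) * (j : ℝ) ^ (-(1 + lam1 / (mu2 - lam2))))) ∧
      (0 < mu2 → lam2 = mu2 →
        (∀ m : ℕ, Tendsto (fun j : ℕ => (j : ℝ) ^ m * (p j).toReal) atTop (𝓝 0)) ∧
        (∀ ε : ℝ, 0 < ε →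
          Tendsto (fun j : ℕ => Real.exp (ε * j) * (p j).toReal) atTop atTop)) ∧
      ((lam2 < mu2 ∨ (0 < lam2 - mu2 ∧ lam2 - mu2 < lam1)) →
        ∫⁻ j, (j : ℝ≥0∞) ∂p.toMeasure = ENNReal.ofReal (lam1 / (lam1 - (lam2 - mu2)))) ∧
      (lam2 = mu2 → ∫⁻ j, (j : ℝ≥0∞) ∂p.toMeasure = 1) ∧
      (¬ (lam2 < mu2 ∨ (0 < lam2 - mu2 ∧ lam2 - mu2 < lam1)) → lam2 ≠ mu2 →
        ∫⁻ j, (j : ℝ≥0∞) ∂p.toMeasure = ∞) := by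
  have hev := eventually_toReal_inDegreePMF hlam1 hlam2 hmu2
  refine ⟨inDegreePMF hlam1 hlam2 hmu2,
    tendsto_measure_uniformVertex hlam1 hlam2 hmu2 hd hD, ?_, ?_, ?_, ?_, ?_, ?_, ?_⟩
  · rintro rfl
    have h := (inDegreeMass_asymp_supercritical hlam1 le_rfl hlam2).congr_left hev
    simpa [hlam2.ne'] using h
  · intro _ h
    exact (inDegreeMass_asymp_supercritical hlam1 hmu2 h).congr_left hev
  · intro _ h
    exact (inDegreeMass_asymp_subcritical hlam1 hlam2 h).congr_left hev
  · rintro _ rfl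
    refine ⟨fun m => ?_, fun ε hε => ?_⟩
    · exact (tendsto_pow_mul_inDegreeMass_critical hlam1 hlam2 m).congr'
        (hev.mono fun j hj => by rw [hj])
    · exact (tendsto_exp_mul_inDegreeMass_critical hlam1 hlam2 hε).congr'
        (hev.mono fun j hj => by rw [hj])
  · intro h
    exact lintegral_inDegreePMF_of_pos hlam1 hlam2 hmu2
      (by rcases h with h | ⟨-, h⟩ <;> linarith)
  · rintro rfl
    rw [lintegral_inDegreePMF_of_pos hlam1 hlam2 hmu2 (by linarith), sub_self, sub_zero,
      div_self hlam1.ne', ENNReal.ofReal_one]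
  · intro h hne
    refine lintegral_inDegreePMF_of_nonpos hlam1 hlam2 hmu2 ?_
    by_contra! hcon
    rcases lt_or_gt_of_ne hne with h1 | h1
    · exact h (Or.inl h1)
    · exact h (Or.inr ⟨by linarith, by linarith⟩)
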